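/- Let $1/2<\gamma<H<1$, $\alpha>1$, $T>0$, and let $\mathbb T^2=\mathbb R^2/\mathbb Z^2$. Let $W^H$ be a fractional Brownian motion with Hurst parameter $H$ on a probability space (a centred Gaussian process with a.s. continuous paths and covariance $\frac12(s^{2H}+t^{2H}-|t-s|^{2H})$, $s,t\ge 0$), and let $\xi$ be a time-independent, divergence-free $C^\infty$ vector field on $\mathbb T^2$. Let $\omega$ be a weak solution on $[0,T]$ of the stochastic vorticity equation $$d\omega_t+u_t\cdot\nabla\omega_t\,dt+\xi\cdot\nabla\omega_t\,dW^H_t=\Delta\omega_t\,dt ,$$ where $u_t=K*\omega_t$ is given by the Biot–Savart law (the mean-zero vector field with $\nabla\cdot u_t=0$ and $\operatorname{curl}u_t=\omega_t$); that is, almost surely $\omega\in C([0,T];H^{2\alpha}(\mathbb T^2))\cap C^\gamma([0,T];H^{2(\alpha-\gamma)}(\mathbb T^2))$, and for every $\psi\in C^\infty(\mathbb T^2)$ and $t\in[0,T]$, almost surely $$\langle\omega_t,\psi\rangle=\langle\omega_0,\psi\rangle+\int_0^t\langle\omega_s,u_s\cdot\nabla\psi+\Delta\psi\rangle\,ds+\int_0^t\langle\omega_s,\xi\cdot\nabla\psi\rangle\,dW^H_s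 ,$$ the last integral being a Young integral (the limit of the left-point sums along dyadic partitions). Let $\varphi$ be a smooth (real- or complex-valued) test function on $\mathbb T^2$ and let $0<t\le T$. For $k\ge 0$ put $$Q_k=\sum_{j\ge 0:\ (j+1)2^{-k}\le t}\bigl|\langle\omega_{(j+1)2^{-k}},\varphi\rangle-\langle\omega_{j2^{-k}},\varphi\rangle\bigr|^2,\qquad H_k=\frac12\left(\frac1{\log 2}\log\frac{Q_k}{Q_{k+1}}+1\right).$$ Then, almost surely on the event $\left\{\int_0^t|\langle\omega_s,\xi\cdot\nabla\varphi\rangle|^2\,ds>0\right\}$, one has $\lim_{k\to\infty}H_k=H$. In particular, if this event has probability one, then $H_k\to H$ almost surely. -/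

import Mathlib

open MeasureTheory ProbabilityTheory Filter Topology
open scoped NNReal ENNReal

noncomputable section

namespace FractionalVorticity

/-- The two-dimensional torus `ℝ² / ℤ²`. -/
abbrev Torus : Type := UnitAddTorus (Fin 2)

/-- Normalised Lebesgue (Haar) measure on the torus. -/
abbrev torusMeasure : Measure Torus := Measure.pi fun _ => AddCircle.haarAddCircle

/-- Real-valued square integrable functions on the torus. -/
abbrev L2 : Type := Lp ℝ 2 torusMeasure

/-! ### Smooth functions on the torus -/

section Smooth

variable {E : Type*} [NormedAddCommGroup E] [NormedSpace ℝ E]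

/-- `φ` is `C^∞` on the torus: its periodic lift to `ℝ²` is `C^∞`. -/
def IsSmooth (φ : Torus → E) : Prop :=
  ContDiff ℝ ((⊤ : ℕ∞) : WithTop ℕ∞) fun x : Fin 2 → ℝ => φ fun i => (x i : UnitAddCircle)

/-- The partial derivative `∂ᵢ φ` on the torus. -/
def pderiv (i : Fin 2) (φ : Torus → E) (x : Torus) : E :=
  deriv (fun h : ℝ => φ (x + Pi.single i (h : UnitAddCircle))) 0

/-- The Laplacian `Δ φ = ∂₀∂₀ φ + ∂₁∂₁ φ`. -/
def laplacian (φ : Torus → E) (x : Torus) : E :=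
  ∑ i, pderiv i (pderiv i φ) x

/-- The transport operator `v · ∇ φ`. -/
def transport (v : Fin 2 → Torus → ℝ) (φ : Torus → E) (x : Torus) : E :=
  ∑ i, v i x • pderiv i φ x

/-- The pairing `⟨f, φ⟩ = ∫ f φ` over the torus. -/
def pairing (f : L2) (φ : Torus → E) : E :=
  ∫ x, f x • φ x ∂torusMeasure

end Smooth

/-- The divergence of a (smooth) vector field. -/
def divergence (v : Fin 2 → Torus → ℝ) (x : Torus) : ℝ :=
  ∑ i, pderiv i (v i) x

/-! ### Sobolev norms -/

/-- The norm of `f` in the Sobolev space `H^s` of the torus, `s ≥ 0`, through Fourier coefficients: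
`‖f‖² = ∑ₖ (1 + |k|²)^s |f̂(k)|²`; it is `∞` exactly when `f ∉ H^s`. -/
def sobolevNorm (s : ℝ) (f : L2) : ℝ≥0∞ :=
  (∑' k : Fin 2 → ℤ, ENNReal.ofReal
    ((1 + ∑ i, (k i : ℝ) ^ 2) ^ s *
      ‖UnitAddTorus.mFourierCoeff (fun x => ((f x : ℝ) : ℂ)) k‖ ^ 2)) ^ (1 / 2 : ℝ)

/-- `y ∈ C([0,T]; H^s)`. -/
def ContinuousInSobolev (s T : ℝ) (y : ℝ → L2) : Prop :=
  ∀ t ∈ Set.Icc 0 T, sobolevNorm s (y t) < ∞ ∧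
    Tendsto (fun r => sobolevNorm s (y r - y t)) (𝓝[Set.Icc 0 T] t) (𝓝 0)

/-- The `γ`-Hölder seminorm of `y : [0,T] → H^s` is finite. -/
def HolderInSobolev (s γ T : ℝ) (y : ℝ → L2) : Prop :=
  ∃ C : ℝ≥0, ∀ r ∈ Set.Icc 0 T, ∀ t ∈ Set.Icc 0 T,
    sobolevNorm s (y t - y r) ≤ C * ENNReal.ofReal (|t - r| ^ γ)

/-- `u = K ∗ w` (Biot-Savart law): `u` is the mean-zero vector field with `∇ · u = 0` and
`curl u = ∂₀ u₁ - ∂₁ u₀ = w`, in the sense of distributions. -/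
structure IsVelocityOf (u : Fin 2 → L2) (w : L2) : Prop where
  mean_zero : ∀ i, ∫ x, u i x ∂torusMeasure = 0
  div_free : ∀ ψ : Torus → ℝ, IsSmooth ψ →
    pairing (u 0) (pderiv 0 ψ) + pairing (u 1) (pderiv 1 ψ) = 0
  curl_eq : ∀ ψ : Torus → ℝ, IsSmooth ψ →
    pairing (u 0) (pderiv 1 ψ) - pairing (u 1) (pderiv 0 ψ) = pairing w ψ

/-! ### Dyadic sums, Young integral, fractional Brownian motion -/

/-- The indices `j` with `[j 2⁻ᵏ, (j+1) 2⁻ᵏ] ⊆ [0,t]`. -/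
def dyadicIndices (k : ℕ) (t : ℝ) : Finset ℕ := Finset.range ⌊t * 2 ^ k⌋₊

theorem mem_dyadicIndices {k : ℕ} {t : ℝ} {j : ℕ} :
    j ∈ dyadicIndices k t ↔ ((j : ℝ) + 1) / 2 ^ k ≤ t := by
  rw [dyadicIndices, Finset.mem_range, ← Nat.succ_le_iff, Nat.le_floor_iff' (Nat.succ_ne_zero j),
    div_le_iff₀ (by positivity)]
  push_cast
  rfl

/-- `∫₀ᵗ x dw = I` as a Young integral, i.e. as the limit of the left-point sums along the dyadic
partitions. -/
def HasYoungIntegral (x w : ℝ → ℝ) (t I : ℝ) : Prop :=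
  Tendsto (fun k : ℕ => ∑ j ∈ dyadicIndices k t,
    x ((j : ℝ) / 2 ^ k) * (w (((j : ℝ) + 1) / 2 ^ k) - w ((j : ℝ) / 2 ^ k))) atTop (𝓝 I)

/-- The sum of the squared increments of `X` over the dyadic grid of mesh `2⁻ᵏ` on `[0,t]`. -/
def dyadicVariation {E : Type*} [NormedAddCommGroup E] (X : ℝ → E) (t : ℝ) (k : ℕ) : ℝ :=
  ∑ j ∈ dyadicIndices k t, ‖X (((j : ℝ) + 1) / 2 ^ k) - X ((j : ℝ) / 2 ^ k)‖ ^ 2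

/-- The ratio estimator `½ ((1 / log 2) log (Qₖ / Qₖ₊₁) + 1)`. -/
def hurstEstimator {E : Type*} [NormedAddCommGroup E] (X : ℝ → E) (t : ℝ) (k : ℕ) : ℝ :=
  1 / 2 * (1 / Real.log 2 *
    Real.log (dyadicVariation X t k / dyadicVariation X t (k + 1)) + 1)

variable {Ω : Type*} [MeasurableSpace Ω]

/-- `W` is, on `[0,∞)`, a fractional Brownian motion with Hurst parameter `H`: a centred Gaussian
process with a.s. continuous paths and covariance `½ (s^{2H} + t^{2H} - |t - s|^{2H})`. -/
structure IsFractionalBrownianMotion (H : ℝ) (W : ℝ → Ω → ℝ) (P : Measure Ω) : Prop where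
  gaussian : IsGaussianProcess (fun t : ℝ≥0 => W t) P
  centered : ∀ t, 0 ≤ t → ∫ p, W t p ∂P = 0
  covariance_eq : ∀ s t, 0 ≤ s → 0 ≤ t →
    cov[W s, W t; P] = (s ^ (2 * H) + t ^ (2 * H) - |t - s| ^ (2 * H)) / 2
  continuous_paths : ∀ᵐ p ∂P, ContinuousOn (fun t => W t p) (Set.Ici 0)

/-! ### The stochastic vorticity equation -/

/-- `ω`, with velocity `u`, is a weak solution on `[0,T]` of
`dω + u · ∇ω dt + ξ · ∇ω dW = Δω dt`
with paths in `C([0,T]; H^{2α}) ∩ C^γ([0,T]; H^{2(α-γ)})`. -/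
structure IsWeakSolution (α γ T : ℝ) (ξ : Fin 2 → Torus → ℝ) (W : ℝ → Ω → ℝ) (P : Measure Ω)
    (ω : ℝ → Ω → L2) (u : ℝ → Ω → Fin 2 → L2) : Prop where
  continuous_path : ∀ᵐ p ∂P, ContinuousInSobolev (2 * α) T fun s => ω s p
  holder_path : ∀ᵐ p ∂P, HolderInSobolev (2 * (α - γ)) γ T fun s => ω s p
  velocity : ∀ᵐ p ∂P, ∀ s ∈ Set.Icc 0 T, IsVelocityOf (u s p) (ω s p)
  /-- `⟨ω_t,φ⟩ = ⟨ω_0,φ⟩ + ∫₀ᵗ ⟨ω_s, u_s · ∇φ + Δφ⟩ ds + ∫₀ᵗ ⟨ω_s, ξ · ∇φ⟩ dW_s`. -/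
  weak_form : ∀ φ : Torus → ℝ, IsSmooth φ → ∀ t ∈ Set.Icc 0 T, ∀ᵐ p ∂P,
    HasYoungIntegral (fun s => pairing (ω s p) (transport ξ φ)) (fun s => W s p) t
      (pairing (ω t p) φ - pairing (ω 0 p) φ -
        ∫ s in (0 : ℝ)..t,
          pairing (ω s p) fun x => transport (fun i => ⇑(u s p i)) φ x + laplacian φ x)

end FractionalVorticity

end

/-!
Rescaled by `2 ^ (k (2H - 1))`, the dyadic square variation `Qₖ` of `⟨ω, φ⟩` converges almost surely
to `∫₀ᵗ |⟨ω_s, ξ · ∇φ⟩|² ds`. Where this limit is positive, `Qₖ / Qₖ₊₁ → 2 ^ (2H - 1)`, which is the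
claim (`tendsto_hurstEstimator`). Splitting `φ` into real and imaginary parts reduces the
convergence to real test functions; write `x_s = ⟨ω_s, ξ · ∇φ⟩`.

* *The noise.* The rescaled square variation of `W` over `[0, s]` converges to `s` almost surely
  (`IsFractionalBrownianMotion.ae_tendsto_dyadicVariation`). Its mean is explicit. By Isserlis'
  formula `Cov(X², Y²) = 2 Cov(X, Y)²`, its variance is controlled by the sum of the squared
  covariances of the increments. For `H ≥ 1/2` these covariances are nonnegative and at most
  `2 ^ (-2kH)`, so one factor can be pulled out and the remaining sum telescopes to a variance of
  `W`. The resulting bound is geometric in `k` because `H < 1`.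
* *The main term.* Since `x²` is continuous, the convergence of the distribution functions above
  gives that of `∑ x² (δW)²` to `∫ x²` (`tendsto_sum_mul_of_tendsto_sum`).
* *The remainder.* Over a dyadic interval the increment of `⟨ω, φ⟩` is `x δW`, plus the remainder of
  the Young integral, plus the drift. Refining the partition from one level to the next changes the
  left-point sums, in `ℓ²` over all intervals, by an amount which the Hölder continuity of `x` and
  the square variation of `W` bound by `2 ^ (-k/2)` times a term of a geometric series, because
  `γ + H > 1` (`exists_sum_sq_young_remainder_le`); no Hölder bound on the paths of `W` is needed.
  The drift is continuous in time, as the Biot–Savart operator is bounded on `L²`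
  (`IsVelocityOf.norm_le`), so its increments are also of size `2 ^ (-k/2)` in `ℓ²`. Both are
  negligible against the main term, which is of size `2 ^ (-k (H - 1/2))`.
-/

namespace FractionalVorticity

/-! ### Gaussian moments and the square variation of fractional Brownian motion -/

lemma integral_pow_four_gaussianReal (v : ℝ≥0) :
    ∫ x, x ^ 4 ∂(gaussianReal 0 v) = 3 * (v : ℝ) ^ 2 := by
  have h := iteratedDeriv_mgf_zero (X := id) (μ := gaussianReal 0 v) (by simp) 4
  have e : ∫ x, x ^ 4 ∂(gaussianReal 0 v) = iteratedDeriv 4 (mgf id (gaussianReal 0 v)) 0 := by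
    rw [h]
    simp
  rw [e, mgf_id_gaussianReal]
  set g : ℝ → ℝ := fun t => Real.exp (0 * t + v * t ^ 2 / 2) with hg
  have hd : ∀ t, HasDerivAt g (v * t * g t) t := fun t => by
    have h1 : HasDerivAt (fun t : ℝ => 0 * t + (v : ℝ) * t ^ 2 / 2) (v * t) t := by
      have := (((hasDerivAt_pow 2 t).const_mul (v : ℝ)).div_const 2).const_add 0
      convert! this using 1
      · ext x; simp
      · simp; ring
    have h2 := h1.exp
    simp only [hg]
    convert! h2 using 1; ring
  have hp : ∀ (q : ℝ → ℝ) (q' t : ℝ), HasDerivAt q q' t →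
      HasDerivAt (fun t => q t * g t) ((q' + q t * (v * t)) * g t) t := fun q q' t hq => by
    convert! hq.mul (hd t) using 1; ring
  have d1 : deriv g = fun t => (v * t) * g t := funext fun t => (hd t).deriv
  have d2 : deriv (fun t => ((v : ℝ) * t) * g t) = fun t => (v + v ^ 2 * t ^ 2) * g t :=
    funext fun t => by
      rw [(hp (fun t => v * t) v t (by simpa using (hasDerivAt_id t).const_mul (v : ℝ))).deriv]
      ring
  have d3 : deriv (fun t => ((v : ℝ) + v ^ 2 * t ^ 2) * g t)
      = fun t => (3 * v ^ 2 * t + v ^ 3 * t ^ 3) * g t := funext fun t => by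
    rw [(hp (fun t => (v : ℝ) + v ^ 2 * t ^ 2) (v ^ 2 * (2 * t)) t
      (by simpa using ((hasDerivAt_pow 2 t).const_mul ((v : ℝ) ^ 2)).const_add (v : ℝ))).deriv]
    ring
  have d4 : deriv (fun t => (3 * (v : ℝ) ^ 2 * t + v ^ 3 * t ^ 3) * g t) 0 = 3 * (v : ℝ) ^ 2 := by
    rw [(hp (fun t => 3 * (v : ℝ) ^ 2 * t + v ^ 3 * t ^ 3)
      (3 * v ^ 2 * 1 + v ^ 3 * (3 * (0 : ℝ) ^ 2)) 0 (by
        convert! ((hasDerivAt_id (0 : ℝ)).const_mul (3 * (v : ℝ) ^ 2)).add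
          ((hasDerivAt_pow 3 (0 : ℝ)).const_mul ((v : ℝ) ^ 3)) using 1)).deriv]
    simp [hg]
  simp only [iteratedDeriv_succ, iteratedDeriv_zero]
  rw [d1, d2, d3, d4]

variable {Ω : Type*} [MeasurableSpace Ω]

lemma integral_pow_four_of_hasGaussianLaw {P : Measure Ω} {X : Ω → ℝ} (hX : HasGaussianLaw X P)
    (h0 : ∫ p, X p ∂P = 0) : ∫ p, X p ^ 4 ∂P = 3 * Var[X; P] ^ 2 := by
  have h1 : ∫ p, X p ^ 4 ∂P = ∫ x, x ^ 4 ∂(P.map X) :=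
    (integral_map hX.aemeasurable (f := fun x : ℝ => x ^ 4) (by fun_prop)).symm
  rw [h1, hX.map_eq_gaussianReal, h0, integral_pow_four_gaussianReal,
    Real.coe_toNNReal _ (variance_nonneg X P)]

lemma integrable_pow_of_hasGaussianLaw {P : Measure Ω} {X : Ω → ℝ}
    (hX : HasGaussianLaw X P) (n : ℕ) : Integrable (fun p => X p ^ n) P := by
  have := hX.isProbabilityMeasure
  rcases Nat.eq_zero_or_pos n with rfl | hn
  · simp
  · have h := (hX.memLp (p := n) (by simp)).integrable_norm_pow (by omega)
    refine h.mono (hX.aemeasurable.pow_const n).aestronglyMeasurable ?_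
    filter_upwards with p
    simp

lemma memLp_sq_of_hasGaussianLaw {P : Measure Ω} {X : Ω → ℝ}
    (hX : HasGaussianLaw X P) : MemLp (fun p => X p ^ 2) 2 P := by
  rw [memLp_two_iff_integrable_sq (hX.aemeasurable.pow_const 2).aestronglyMeasurable]
  refine (integrable_pow_of_hasGaussianLaw hX 4).congr ?_
  filter_upwards with p
  ring

/-- Isserlis' formula for a centred Gaussian pair; by polarisation it follows from the fourth moment
of a single Gaussian variable. -/
lemma covariance_sq_sq {P : Measure Ω} {X Y : Ω → ℝ}
    (hXY : HasGaussianLaw (fun p => (X p, Y p)) P) (hX0 : ∫ p, X p ∂P = 0)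
    (hY0 : ∫ p, Y p ∂P = 0) :
    cov[fun p => X p ^ 2, fun p => Y p ^ 2; P] = 2 * cov[X, Y; P] ^ 2 := by
  have := hXY.isProbabilityMeasure
  have hX := hXY.fst
  have hY := hXY.snd
  have hadd := hXY.fun_add
  have hsub := hXY.fun_sub
  have ia := hX.integrable
  have ib := hY.integrable
  have va : Var[fun p => X p + Y p; P] = Var[X; P] + 2 * cov[X, Y; P] + Var[Y; P] :=
    variance_fun_add hX.memLp_two hY.memLp_two
  have vs : Var[fun p => X p - Y p; P] = Var[X; P] - 2 * cov[X, Y; P] + Var[Y; P] :=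
    variance_fun_sub hX.memLp_two hY.memLp_two
  have ma := integral_pow_four_of_hasGaussianLaw hadd (by rw [integral_add ia ib, hX0, hY0]; simp)
  have ms := integral_pow_four_of_hasGaussianLaw hsub (by rw [integral_sub ia ib, hX0, hY0]; simp)
  have mx := integral_pow_four_of_hasGaussianLaw hX hX0
  have my := integral_pow_four_of_hasGaussianLaw hY hY0
  have ea : ∫ p, X p ^ 2 ∂P = Var[X; P] := (variance_of_integral_eq_zero hX.aemeasurable hX0).symm
  have eb : ∫ p, Y p ^ 2 ∂P = Var[Y; P] := (variance_of_integral_eq_zero hY.aemeasurable hY0).symm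
  rw [covariance_eq_sub (memLp_sq_of_hasGaussianLaw hX) (memLp_sq_of_hasGaussianLaw hY), ea, eb]
  -- polarisation: `12 X² Y² = (X + Y)⁴ + (X - Y)⁴ - 2 X⁴ - 2 Y⁴`
  have e : ∫ p, ((fun p => X p ^ 2) * fun p => Y p ^ 2) p ∂P
      = (∫ p, (X p + Y p) ^ 4 ∂P + ∫ p, (X p - Y p) ^ 4 ∂P - 2 * ∫ p, X p ^ 4 ∂P
        - 2 * ∫ p, Y p ^ 4 ∂P) / 12 := by
    have i1 := integrable_pow_of_hasGaussianLaw hadd 4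
    have i2 := integrable_pow_of_hasGaussianLaw hsub 4
    have i3 := (integrable_pow_of_hasGaussianLaw hX 4).const_mul 2
    have i4 := (integrable_pow_of_hasGaussianLaw hY 4).const_mul 2
    rw [← integral_const_mul, ← integral_const_mul, ← integral_add i1 i2,
      ← integral_sub (by exact i1.add i2) i3, ← integral_sub (by exact (i1.add i2).sub i3) i4,
      ← integral_div]
    refine integral_congr_ae (Eventually.of_forall fun p => ?_)
    simp only [Pi.mul_apply]
    ring
  rw [e, ma, ms, mx, my, va, vs]
  ring

/-- Midpoint convexity of `x ↦ |x| ^ p` for `p ≥ 1`. -/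
lemma two_mul_abs_rpow_le {p : ℝ} (hp : 1 ≤ p) (d h : ℝ) :
    2 * |d| ^ p ≤ |d + h| ^ p + |d - h| ^ p := by
  have h1 : |d| ≤ (1 / 2) * |d + h| + (1 / 2) * |d - h| := by
    have := abs_add_le (d + h) (d - h)
    rw [show d + h + (d - h) = 2 * d by ring, abs_mul, abs_two] at this
    linarith
  have h2 := (convexOn_rpow hp).2 (Set.mem_Ici.2 (abs_nonneg (d + h)))
    (Set.mem_Ici.2 (abs_nonneg (d - h))) (by norm_num : (0 : ℝ) ≤ 1 / 2)
    (by norm_num : (0 : ℝ) ≤ 1 / 2) (by norm_num)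
  have h3 := Real.rpow_le_rpow (abs_nonneg d) h1 (by linarith : 0 ≤ p)
  simp only [smul_eq_mul] at h2
  linarith

namespace IsFractionalBrownianMotion

variable {H : ℝ} {W : ℝ → Ω → ℝ} {P : Measure Ω}

lemma hasGaussianLaw (hW : IsFractionalBrownianMotion H W P) {s : ℝ} (hs : 0 ≤ s) :
    HasGaussianLaw (W s) P :=
  hW.gaussian.hasGaussianLaw_eval ⟨s, hs⟩

/-- The covariance of two increments of the same length `h` is a second difference of
`x ↦ |x| ^ (2 * H)`. -/
lemma covariance_increment [IsProbabilityMeasure P] (hW : IsFractionalBrownianMotion H W P)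
    {a b h : ℝ} (ha : 0 ≤ a) (hb : 0 ≤ b) (hh : 0 ≤ h) :
    cov[fun p => W (a + h) p - W a p, fun p => W (b + h) p - W b p; P]
      = (|(b - a) + h| ^ (2 * H) + |(b - a) - h| ^ (2 * H) - 2 * |b - a| ^ (2 * H)) / 2 := by
  have m : ∀ {s : ℝ}, 0 ≤ s → MemLp (W s) 2 P := fun hs => (hW.hasGaussianLaw hs).memLp_two
  rw [covariance_fun_sub_fun_sub (m (by positivity)) (m ha) (m (by positivity)) (m hb),
    hW.covariance_eq _ _ (by positivity) (by positivity), hW.covariance_eq _ _ (by positivity) hb,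
    hW.covariance_eq _ _ ha (by positivity), hW.covariance_eq _ _ ha hb,
    show b + h - (a + h) = b - a by ring, show b - (a + h) = (b - a) - h by ring,
    show b + h - a = (b - a) + h by ring]
  ring

lemma variance_increment [IsProbabilityMeasure P] (hW : IsFractionalBrownianMotion H W P)
    (hH : 0 < H) {a h : ℝ} (ha : 0 ≤ a) (hh : 0 ≤ h) :
    Var[fun p => W (a + h) p - W a p; P] = h ^ (2 * H) := by
  have m : AEMeasurable (fun p => W (a + h) p - W a p) P :=
    (hW.hasGaussianLaw (by positivity)).aemeasurable.sub (hW.hasGaussianLaw ha).aemeasurable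
  rw [← covariance_self m, hW.covariance_increment ha ha hh]
  simp only [sub_self, zero_add, zero_sub, abs_neg, abs_zero, abs_of_nonneg hh]
  rw [Real.zero_rpow (by positivity)]
  ring

lemma integral_increment (hW : IsFractionalBrownianMotion H W P)
    {a b : ℝ} (ha : 0 ≤ a) (hb : 0 ≤ b) : ∫ p, (W b p - W a p) ∂P = 0 := by
  rw [integral_sub (hW.hasGaussianLaw hb).integrable (hW.hasGaussianLaw ha).integrable,
    hW.centered _ ha, hW.centered _ hb, sub_zero]

/-- For `H ≥ 1/2` the increments are positively correlated. -/
lemma covariance_increment_nonneg [IsProbabilityMeasure P] (hW : IsFractionalBrownianMotion H W P)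
    (hH : 1 / 2 ≤ H) {a b h : ℝ} (ha : 0 ≤ a) (hb : 0 ≤ b) (hh : 0 ≤ h) :
    0 ≤ cov[fun p => W (a + h) p - W a p, fun p => W (b + h) p - W b p; P] := by
  rw [hW.covariance_increment ha hb hh]
  have := two_mul_abs_rpow_le (p := 2 * H) (by linarith) (b - a) h
  linarith

/-- Both increments have variance `h ^ (2 * H)`, and their difference has nonnegative variance. -/
lemma covariance_increment_le [IsProbabilityMeasure P] (hW : IsFractionalBrownianMotion H W P)
    (hH : 0 < H) {a b h : ℝ} (ha : 0 ≤ a) (hb : 0 ≤ b) (hh : 0 ≤ h) :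
    cov[fun p => W (a + h) p - W a p, fun p => W (b + h) p - W b p; P] ≤ h ^ (2 * H) := by
  have m : ∀ {s : ℝ}, 0 ≤ s → MemLp (W s) 2 P := fun hs => (hW.hasGaussianLaw hs).memLp_two
  have hA : MemLp (fun p => W (a + h) p - W a p) 2 P := (m (by positivity)).sub (m ha)
  have hB : MemLp (fun p => W (b + h) p - W b p) 2 P := (m (by positivity)).sub (m hb)
  have h1 := variance_fun_sub hA hB
  have h2 := variance_nonneg (fun p => (W (a + h) p - W a p) - (W (b + h) p - W b p)) P
  rw [h1, hW.variance_increment hH ha hh, hW.variance_increment hH hb hh] at h2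
  linarith

/-- The variance of the sum of the squares of `n` consecutive increments. By Isserlis' formula it
is `2 ∑ᵢⱼ cᵢⱼ²` with `cᵢⱼ` the covariances of the increments; as `0 ≤ cᵢⱼ ≤ h ^ (2 * H)`, this is
at most `2 h ^ (2 * H) ∑ᵢⱼ cᵢⱼ`, and the last sum telescopes to the variance of `W (n * h)`. -/
lemma variance_sum_sq_increment_le [IsProbabilityMeasure P]
    (hW : IsFractionalBrownianMotion H W P) (hH : 1 / 2 ≤ H) {h : ℝ} (hh : 0 ≤ h) (n : ℕ) :
    Var[fun p => ∑ j ∈ Finset.range n, (W (((j : ℝ) + 1) * h) p - W ((j : ℝ) * h) p) ^ 2; P]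
      ≤ 2 * h ^ (2 * H) * ((n : ℝ) * h) ^ (2 * H) := by
  have hH0 : 0 < H := by linarith
  set D : ℕ → Ω → ℝ := fun j p => W (((j : ℝ) + 1) * h) p - W ((j : ℝ) * h) p with hD
  have hDe : ∀ j, D j = fun p => W ((j : ℝ) * h + h) p - W ((j : ℝ) * h) p := fun j => by
    simp only [hD, add_mul, one_mul]
  have hj : ∀ j : ℕ, 0 ≤ (j : ℝ) * h := fun j => by positivity
  have hvec : HasGaussianLaw (fun p (i : Fin n) => D i p) P := by
    have := hW.gaussian.hasGaussianLaw_increments (n := n)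
      (t := fun i => ⟨((i : ℕ) : ℝ) * h, hj i⟩)
    simp only [Fin.val_succ, Fin.val_castSucc, Nat.cast_add, Nat.cast_one] at this
    exact this
  have hpair : ∀ i ∈ Finset.range n, ∀ j ∈ Finset.range n,
      HasGaussianLaw (fun p => (D i p, D j p)) P := fun i hi j hj' =>
    hvec.prodMk ⟨i, Finset.mem_range.1 hi⟩ ⟨j, Finset.mem_range.1 hj'⟩
  have hm0 : ∀ j, ∫ p, D j p ∂P = 0 := fun j => hW.integral_increment (hj j) (by positivity)
  have hlaw : ∀ i ∈ Finset.range n, HasGaussianLaw (D i) P := fun i hi => (hpair i hi i hi).fst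
  have hsq : ∀ i ∈ Finset.range n, MemLp (fun p => D i p ^ 2) 2 P := fun i hi =>
    memLp_sq_of_hasGaussianLaw (hlaw i hi)
  have hself : Var[fun p => ∑ j ∈ Finset.range n, D j p ^ 2; P]
      = ∑ i ∈ Finset.range n, ∑ j ∈ Finset.range n,
        cov[fun p => D i p ^ 2, fun p => D j p ^ 2; P] := by
    rw [← covariance_self (memLp_finsetSum _ hsq).aestronglyMeasurable.aemeasurable,
      covariance_fun_sum_fun_sum' hsq hsq]
  have htel : ∑ i ∈ Finset.range n, ∑ j ∈ Finset.range n, cov[D i, D j; P]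
      = ((n : ℝ) * h) ^ (2 * H) := by
    rw [← covariance_fun_sum_fun_sum' (fun i hi => (hlaw i hi).memLp_two)
      (fun i hi => (hlaw i hi).memLp_two)]
    have : (fun p => ∑ j ∈ Finset.range n, D j p)
        = fun p => W (0 + (n : ℝ) * h) p - W 0 p := by
      ext p
      have := Finset.sum_range_sub (fun j : ℕ => W ((j : ℝ) * h) p) n
      simpa [hD] using this
    rw [this, covariance_self, hW.variance_increment hH0 le_rfl (hj n)]
    exact (hW.hasGaussianLaw (by simpa using hj n)).aemeasurable.sub
      (hW.hasGaussianLaw le_rfl).aemeasurable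
  rw [hself, ← htel, Finset.mul_sum]
  refine Finset.sum_le_sum fun i hi => ?_
  rw [Finset.mul_sum]
  refine Finset.sum_le_sum fun j hj' => ?_
  rw [covariance_sq_sq (hpair i hi j hj') (hm0 i) (hm0 j)]
  have c0 := hW.covariance_increment_nonneg hH (hj i) (hj j) hh
  have c1 := hW.covariance_increment_le hH0 (hj i) (hj j) hh
  rw [← hDe, ← hDe] at c0 c1
  nlinarith

end IsFractionalBrownianMotion

/-- Nonnegative random variables with summable expectations tend to `0` almost surely. -/
lemma ae_tendsto_zero_of_summable_integral {P : Measure Ω} {f : ℕ → Ω → ℝ}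
    (hf : ∀ k, Integrable (f k) P) (h0 : ∀ k p, 0 ≤ f k p)
    (hs : Summable fun k => ∫ p, f k p ∂P) :
    ∀ᵐ p ∂P, Tendsto (fun k => f k p) atTop (𝓝 0) := by
  have h1 : ∫⁻ p, ∑' k, ENNReal.ofReal (f k p) ∂P ≠ ∞ := by
    rw [lintegral_tsum fun k => (hf k).aemeasurable.ennreal_ofReal]
    have : ∀ k, ∫⁻ p, ENNReal.ofReal (f k p) ∂P = ENNReal.ofReal (∫ p, f k p ∂P) := fun k =>
      (ofReal_integral_eq_lintegral_ofReal (hf k) (Eventually.of_forall (h0 k))).symm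
    simp_rw [this]
    rw [← ENNReal.ofReal_tsum_of_nonneg (fun k => integral_nonneg (h0 k)) hs]
    exact ENNReal.ofReal_ne_top
  have h2 := ae_lt_top' (AEMeasurable.tsum fun k => (hf k).aemeasurable.ennreal_ofReal) h1
  filter_upwards [h2] with p hp
  have h3 := ENNReal.tendsto_atTop_zero_of_tsum_ne_top hp.ne
  have h4 := (ENNReal.tendsto_toReal ENNReal.zero_ne_top).comp h3
  refine h4.congr fun k => ?_
  simp [ENNReal.toReal_ofReal (h0 k p)]

lemma inv_two_pow_rpow (k : ℕ) (y : ℝ) : (((2 : ℝ) ^ k)⁻¹) ^ y = ((2 : ℝ) ^ (-y)) ^ k := by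
  rw [← Real.rpow_natCast, ← Real.rpow_natCast, ← Real.rpow_neg (by norm_num),
    ← Real.rpow_mul (by norm_num), ← Real.rpow_mul (by norm_num)]
  congr 1; ring

lemma tendsto_floor_mul_two_pow {s : ℝ} (hs : 0 ≤ s) :
    Tendsto (fun k : ℕ => (⌊s * 2 ^ k⌋₊ : ℝ) * ((2 : ℝ) ^ k)⁻¹) atTop (𝓝 s) := by
  have h := (tendsto_nat_floor_mul_div_atTop (R := ℝ) hs).comp
    (tendsto_pow_atTop_atTop_of_one_lt (one_lt_two (α := ℝ)))
  refine h.congr fun k => ?_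
  simp [div_eq_mul_inv]

/-- The rescaled quadratic variation of a fractional Brownian motion along the dyadic grids. -/
theorem IsFractionalBrownianMotion.ae_tendsto_dyadicVariation {H : ℝ} {W : ℝ → Ω → ℝ}
    {P : Measure Ω} [IsProbabilityMeasure P] (hW : IsFractionalBrownianMotion H W P)
    (hH : 1 / 2 ≤ H) (hH' : H < 1) {s : ℝ} (hs : 0 ≤ s) :
    ∀ᵐ p ∂P, Tendsto (fun k => ((2 : ℝ) ^ (2 * H - 1)) ^ k *
      dyadicVariation (fun r => W r p) s k) atTop (𝓝 s) := by
  have hH0 : 0 < H := by linarith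
  set a : ℝ := (2 : ℝ) ^ (2 * H - 1) with ha
  have ha0 : 0 < a := by positivity
  set S : ℕ → Ω → ℝ := fun k p => dyadicVariation (fun r => W r p) s k with hS
  have hSe : ∀ k, S k = fun p => ∑ j ∈ Finset.range ⌊s * 2 ^ k⌋₊,
      (W (((j : ℝ) + 1) * ((2 : ℝ) ^ k)⁻¹) p - W ((j : ℝ) * ((2 : ℝ) ^ k)⁻¹) p) ^ 2 := fun k => by
    ext p
    simp [hS, dyadicVariation, dyadicIndices, div_eq_mul_inv]
  have hincr : ∀ k j : ℕ, HasGaussianLaw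
      (fun p => W (((j : ℝ) + 1) * ((2 : ℝ) ^ k)⁻¹) p - W ((j : ℝ) * ((2 : ℝ) ^ k)⁻¹) p) P :=
    fun k j => hW.gaussian.hasGaussianLaw_fun_sub
      (s := ⟨((j : ℝ) + 1) * ((2 : ℝ) ^ k)⁻¹, by positivity⟩)
      (t := ⟨(j : ℝ) * ((2 : ℝ) ^ k)⁻¹, by positivity⟩)
  have hSm : ∀ k, MemLp (S k) 2 P := fun k => by
    rw [hSe]
    exact memLp_finsetSum _ fun j _ => memLp_sq_of_hasGaussianLaw (hincr k j)
  have hmean : ∀ k, ∫ p, S k p ∂P = (⌊s * 2 ^ k⌋₊ : ℝ) * (((2 : ℝ) ^ k)⁻¹) ^ (2 * H) := fun k => by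
    rw [hSe, integral_finsetSum _ fun j _ => integrable_pow_of_hasGaussianLaw (hincr k j) 2]
    rw [Finset.sum_congr rfl fun j _ => ?_, Finset.sum_const, Finset.card_range, nsmul_eq_mul]
    rw [← hW.variance_increment hH0 (a := (j : ℝ) * ((2 : ℝ) ^ k)⁻¹) (by positivity)
      (by positivity), variance_of_integral_eq_zero]
    · simp [add_mul]
    · simpa [add_mul] using (hincr k j).aemeasurable
    · exact hW.integral_increment (by positivity) (by positivity)
  have hscale : ∀ k, a ^ k * (((2 : ℝ) ^ k)⁻¹) ^ (2 * H) = ((2 : ℝ) ^ k)⁻¹ := fun k => by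
    rw [inv_two_pow_rpow, ha, ← mul_pow, ← Real.rpow_add (by norm_num), ← inv_pow]
    congr 1
    rw [show 2 * H - 1 + -(2 * H) = -1 by ring, Real.rpow_neg_one]
  set r : ℝ := (2 : ℝ) ^ (2 * H - 2) with hr
  have hr1 : r < 1 := Real.rpow_lt_one_of_one_lt_of_neg (by norm_num) (by linarith)
  have hr0 : 0 ≤ r := by positivity
  -- The variance bound `2 h ^ (2H) s ^ (2H)` with `h = 2 ^ (-k)`, rescaled by `2 ^ (2k (2H - 1))`,
  -- is geometric of ratio `2 ^ (2H - 2)`.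
  have hvar : ∀ k, ∫ p, (a ^ k * S k p - a ^ k * ∫ q, S k q ∂P) ^ 2 ∂P
      ≤ 2 * s ^ (2 * H) * r ^ k := fun k => by
    have e : ∀ p, (a ^ k * S k p - a ^ k * ∫ q, S k q ∂P) ^ 2
        = (a ^ k) ^ 2 * (S k p - ∫ q, S k q ∂P) ^ 2 := fun p => by ring
    simp_rw [e]
    rw [integral_const_mul, ← variance_eq_integral (hSm k).aestronglyMeasurable.aemeasurable]
    have hv : Var[S k; P] ≤ 2 * (((2 : ℝ) ^ k)⁻¹) ^ (2 * H) *
        ((⌊s * 2 ^ k⌋₊ : ℝ) * ((2 : ℝ) ^ k)⁻¹) ^ (2 * H) := by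
      rw [hSe]
      exact hW.variance_sum_sq_increment_le hH (by positivity) ⌊s * 2 ^ k⌋₊
    have hn : (⌊s * 2 ^ k⌋₊ : ℝ) * ((2 : ℝ) ^ k)⁻¹ ≤ s := by
      rw [← div_eq_mul_inv, div_le_iff₀ (by positivity)]
      exact Nat.floor_le (by positivity)
    have hn' : ((⌊s * 2 ^ k⌋₊ : ℝ) * ((2 : ℝ) ^ k)⁻¹) ^ (2 * H) ≤ s ^ (2 * H) :=
      Real.rpow_le_rpow (by positivity) hn (by positivity)
    have hrk : a ^ k * ((2 : ℝ) ^ k)⁻¹ = r ^ k := by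
      rw [ha, hr, ← inv_pow, ← mul_pow, ← Real.rpow_neg_one, ← Real.rpow_add (by norm_num)]
      congr 2; ring
    calc (a ^ k) ^ 2 * Var[S k; P]
        ≤ (a ^ k) ^ 2 * (2 * (((2 : ℝ) ^ k)⁻¹) ^ (2 * H) * s ^ (2 * H)) := by
          gcongr
          exact hv.trans (by gcongr)
      _ = 2 * s ^ (2 * H) * (a ^ k * (a ^ k * (((2 : ℝ) ^ k)⁻¹) ^ (2 * H))) := by ring
      _ = 2 * s ^ (2 * H) * r ^ k := by rw [hscale, hrk]
  have hint : ∀ k, Integrable (fun p => (a ^ k * S k p - a ^ k * ∫ q, S k q ∂P) ^ 2) P :=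
    fun k => (((hSm k).const_mul (a ^ k)).sub (memLp_const _)).integrable_sq
  have hlim := ae_tendsto_zero_of_summable_integral hint (fun k p => sq_nonneg _)
    (Summable.of_nonneg_of_le (fun k => integral_nonneg fun p => sq_nonneg _) hvar
      ((summable_geometric_of_lt_one hr0 hr1).mul_left _))
  filter_upwards [hlim] with p hp
  have h1 : Tendsto (fun k => a ^ k * S k p - a ^ k * ∫ q, S k q ∂P) atTop (𝓝 0) := by
    rw [tendsto_zero_iff_abs_tendsto_zero]
    have := hp.sqrt
    simpa [Function.comp_def, Real.sqrt_sq_eq_abs] using this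
  have h2 := h1.add (tendsto_floor_mul_two_pow hs)
  rw [zero_add] at h2
  refine h2.congr fun k => ?_
  linear_combination (⌊s * 2 ^ k⌋₊ : ℝ) * (-hscale k) - a ^ k * hmean k

/-! ### Riemann–Stieltjes sums and Young integrals along dyadic partitions -/

lemma sum_range_mul_eq {M : Type*} [AddCommMonoid M] (f : ℕ → M) (n m : ℕ) :
    ∑ r ∈ Finset.range (n * m), f r
      = ∑ j ∈ Finset.range n, ∑ l ∈ Finset.range m, f (j * m + l) := by
  induction n with
  | zero => simp
  | succ n ih => rw [Nat.succ_mul, Finset.sum_range_add, ih, Finset.sum_range_succ]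

/-- Riemann–Stieltjes convergence along the dyadic grids: if nonnegative weights have distribution
functions converging to that of Lebesgue measure, then the weighted sums of a continuous function
converge to its integral. -/
lemma tendsto_sum_mul_of_tendsto_sum {c : ℕ → ℕ → ℝ} (hc : ∀ k j, 0 ≤ c k j) {t : ℝ} (ht : 0 < t)
    (hV : ∀ N i : ℕ, Tendsto (fun k => ∑ j ∈ dyadicIndices k (t * i / N), c k j) atTop
      (𝓝 (t * i / N)))
    {f : ℝ → ℝ} (hf : ContinuousOn f (Set.Icc 0 t)) :
    Tendsto (fun k => ∑ j ∈ dyadicIndices k t, c k j * f ((j : ℝ) / 2 ^ k)) atTop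
      (𝓝 (∫ s in (0 : ℝ)..t, f s)) := by
  rw [Metric.tendsto_atTop']
  intro ε' hε'
  obtain ⟨ε, hε, hεε⟩ : ∃ ε > 0, ε * (t + 1) + ε + ε * t < ε' := by
    refine ⟨ε' / (2 * (2 * t + 2)), by positivity, ?_⟩
    rw [show ε' / (2 * (2 * t + 2)) * (t + 1) + ε' / (2 * (2 * t + 2)) + ε' / (2 * (2 * t + 2)) * t
      = ε' / 2 by field_simp; ring]
    linarith
  have huc := isCompact_Icc.uniformContinuousOn_of_continuous hf
  rw [Metric.uniformContinuousOn_iff_le] at huc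
  obtain ⟨δ, hδ, huc⟩ := huc ε hε
  obtain ⟨N, hN⟩ := exists_nat_gt (2 * t / δ)
  have hN0 : (0 : ℝ) < N := lt_of_le_of_lt (by positivity) hN
  have hNδ : 2 * (t / N) ≤ δ := by
    rw [div_lt_iff₀ hδ] at hN
    rw [← mul_div_assoc, div_le_iff₀ hN0]; linarith
  set s : ℕ → ℝ := fun i => t * i / N with hs
  have hs0 : s 0 = 0 := by simp [hs]
  have hsN : s N = t := by simp [hs, hN0.ne']
  have hss : ∀ i, s (i + 1) = s i + t / N := fun i => by simp only [hs]; push_cast; ring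
  have hsnn : ∀ i, 0 ≤ s i := fun i => by positivity
  have hsmono : Monotone s := monotone_nat_of_le_succ fun i => by
    rw [hss]; have : 0 ≤ t / N := by positivity
    linarith
  have hst : ∀ i ≤ N, s i ≤ t := fun i hi => hsN ▸ hsmono hi
  -- The integral against its Riemann sum.
  set J : ℝ := ∑ i ∈ Finset.range N, f (s i) * (s (i + 1) - s i) with hJ
  have hII : ∀ i < N, IntervalIntegrable f volume (s i) (s (i + 1)) := fun i hi =>
    (hf.mono (by
      rw [Set.uIcc_of_le (hsmono (Nat.le_succ i))]
      exact Set.Icc_subset_Icc (hsnn i) (hst _ hi))).intervalIntegrable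
  have h1 : |(∫ r in (0 : ℝ)..t, f r) - J| ≤ ε * t := by
    have e1 := intervalIntegral.sum_integral_adjacent_intervals hII
    rw [hs0, hsN] at e1
    rw [← e1, hJ, ← Finset.sum_sub_distrib]
    refine (Finset.abs_sum_le_sum_abs _ _).trans ?_
    have e2 : ε * t = ∑ i ∈ Finset.range N, ε * (s (i + 1) - s i) := by
      rw [← Finset.mul_sum, Finset.sum_range_sub, hs0, hsN, sub_zero]
    rw [e2]
    refine Finset.sum_le_sum fun i hi => ?_
    have hi := Finset.mem_range.1 hi
    have e3 : (∫ r in s i..s (i + 1), f r) - f (s i) * (s (i + 1) - s i)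
        = ∫ r in s i..s (i + 1), (f r - f (s i)) := by
      rw [intervalIntegral.integral_sub (hII i hi) intervalIntegrable_const]
      simp; ring
    rw [e3, ← Real.norm_eq_abs]
    have e4 := intervalIntegral.norm_integral_le_of_norm_le_const (a := s i) (b := s (i + 1))
      (C := ε) (f := fun r => f r - f (s i)) fun r hr => by
        rw [Set.uIoc_of_le (hsmono (Nat.le_succ i))] at hr
        rw [← dist_eq_norm]
        refine huc r ⟨(hsnn i).trans hr.1.le, hr.2.trans (hst _ hi)⟩ (s i)
          ⟨hsnn i, hst _ hi.le⟩ ?_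
        rw [Real.dist_eq, abs_of_nonneg (by linarith [hr.1])]
        have := hr.2
        rw [hss] at this
        have : 0 ≤ t / N := by positivity
        linarith
    rwa [abs_of_nonneg (sub_nonneg.2 (hsmono (Nat.le_succ i)))] at e4
  -- The weighted sum against the corresponding Riemann–Stieltjes sum. The grid points attributed to
  -- `[s i, s (i + 1)]` may lie below `s i` by at most `2 ^ (-k)`, whence the factor 2 in the choice
  -- of `N`.
  set V : ℕ → ℕ → ℝ := fun k i => ∑ j ∈ dyadicIndices k (s i), c k j with hVdef
  have h2 : Tendsto (fun k => ∑ i ∈ Finset.range N, f (s i) * (V k (i + 1) - V k i)) atTop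
      (𝓝 J) :=
    tendsto_finsetSum _ fun i _ => ((hV N (i + 1)).sub (hV N i)).const_mul _
  have hsmall : ∀ᶠ k : ℕ in atTop, 1 / (2 : ℝ) ^ k ≤ t / N := by
    have : Tendsto (fun k : ℕ => 1 / (2 : ℝ) ^ k) atTop (𝓝 0) := by
      simpa [one_div, ← inv_pow] using
        tendsto_pow_atTop_nhds_zero_of_lt_one (r := (2 : ℝ)⁻¹) (by norm_num) (by norm_num)
    exact this.eventually_le_const (by positivity)
  have h3 : ∀ᶠ k in atTop, |(∑ j ∈ dyadicIndices k t, c k j * f ((j : ℝ) / 2 ^ k))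
      - ∑ i ∈ Finset.range N, f (s i) * (V k (i + 1) - V k i)| ≤ ε * V k N := by
    filter_upwards [hsmall] with k hk
    have hp : (0 : ℝ) < 2 ^ k := by positivity
    set n : ℕ → ℕ := fun i => ⌊s i * 2 ^ k⌋₊ with hn
    have hnm : ∀ i, n i ≤ n (i + 1) := fun i => Nat.floor_mono (by
      have := hsmono (Nat.le_succ i)
      gcongr)
    have e1 : ∀ (g : ℕ → ℝ), ∑ j ∈ Finset.range (n N), g j
        = ∑ i ∈ Finset.range N, ∑ j ∈ Finset.Ico (n i) (n (i + 1)), g j := fun g => by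
      have := Finset.sum_range_sub (fun i => ∑ j ∈ Finset.range (n i), g j) N
      have hn0 : n 0 = 0 := by simp [hn, hs0]
      simp only [hn0, Finset.range_zero, Finset.sum_empty, sub_zero] at this
      rw [← this]
      exact Finset.sum_congr rfl fun i _ => (Finset.sum_Ico_eq_sub _ (hnm i)).symm
    have e2 : ∀ i, V k (i + 1) - V k i = ∑ j ∈ Finset.Ico (n i) (n (i + 1)), c k j := fun i =>
      (Finset.sum_Ico_eq_sub _ (hnm i)).symm
    have e3 : dyadicIndices k t = Finset.range (n N) := by simp only [hn, hsN, dyadicIndices]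
    have e4 : V k N = ∑ j ∈ Finset.range (n N), c k j := rfl
    rw [e3, e4, e1, e1, ← Finset.sum_sub_distrib, Finset.mul_sum]
    refine (Finset.abs_sum_le_sum_abs _ _).trans (Finset.sum_le_sum fun i hi => ?_)
    have hi := Finset.mem_range.1 hi
    rw [e2, Finset.mul_sum, Finset.mul_sum, ← Finset.sum_sub_distrib]
    refine (Finset.abs_sum_le_sum_abs _ _).trans (Finset.sum_le_sum fun j hj => ?_)
    rw [Finset.mem_Ico] at hj
    have j1 : (j : ℝ) + 1 ≤ s (i + 1) * 2 ^ k := by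
      have := (Nat.le_floor_iff (by have := hsnn (i + 1); positivity)).1 (Nat.succ_le_of_lt hj.2)
      exact_mod_cast this
    have j2 : s i * 2 ^ k < (j : ℝ) + 1 :=
      (Nat.lt_floor_add_one _).trans_le (by
        have : (n i : ℝ) ≤ j := Nat.cast_le.2 hj.1
        simp only [hn] at this
        linarith)
    have j3 : (j : ℝ) / 2 ^ k ≤ s (i + 1) := by rw [div_le_iff₀ hp]; linarith
    have j4 : s i ≤ (j : ℝ) / 2 ^ k + 1 / 2 ^ k := by
      rw [← add_div, le_div_iff₀ hp]; exact j2.le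
    have e5 := huc ((j : ℝ) / 2 ^ k) ⟨by positivity, j3.trans (hst _ hi)⟩ (s i)
      ⟨hsnn i, hst _ hi.le⟩ (by
        rw [hss] at j3
        have : 0 ≤ t / N := by positivity
        rw [Real.dist_eq, abs_le]; constructor <;> linarith)
    rw [Real.dist_eq] at e5
    rw [show c k j * f ((j : ℝ) / 2 ^ k) - f (s i) * c k j
      = c k j * (f ((j : ℝ) / 2 ^ k) - f (s i)) by ring, abs_mul, abs_of_nonneg (hc k j),
      mul_comm ε]
    exact mul_le_mul_of_nonneg_left e5 (hc k j)
  have h4 : ∀ᶠ k in atTop, V k N ≤ t + 1 := by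
    have := hV N N
    change Tendsto (fun k => V k N) atTop (𝓝 (s N)) at this
    rw [hsN] at this
    exact this.eventually_le_const (by linarith)
  have h5 := Metric.tendsto_nhds.1 h2 ε hε
  have h6 : ∀ᶠ k in atTop, dist (∑ j ∈ dyadicIndices k t, c k j * f ((j : ℝ) / 2 ^ k))
      (∫ s in (0 : ℝ)..t, f s) < ε' := by
    filter_upwards [h3, h4, h5] with k a3 a4 a5
    rw [Real.dist_eq] at a5 ⊢
    have a6 : ε * V k N ≤ ε * (t + 1) := by gcongr
    rw [abs_lt] at a5 ⊢
    rw [abs_le] at a3 h1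
    constructor <;> linarith [a3.1, a3.2, h1.1, h1.2, a5.1, a5.2]
  obtain ⟨K, hK⟩ := eventually_atTop.1 h6
  exact ⟨K, fun k hk => hK k hk.le⟩

/-- The left-point sum of `x dw` of level `k + i` over the `j`-th dyadic interval of level `k`. -/
noncomputable def blockSum (x w : ℝ → ℝ) (k i j : ℕ) : ℝ :=
  ∑ l ∈ Finset.range (2 ^ i), x (((j * 2 ^ i + l : ℕ) : ℝ) / 2 ^ (k + i)) *
    (w ((((j * 2 ^ i + l : ℕ) : ℝ) + 1) / 2 ^ (k + i)) -
      w (((j * 2 ^ i + l : ℕ) : ℝ) / 2 ^ (k + i)))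

lemma blockSum_zero (x w : ℝ → ℝ) (k j : ℕ) :
    blockSum x w k 0 j =
      x ((j : ℝ) / 2 ^ k) * (w (((j : ℝ) + 1) / 2 ^ k) - w ((j : ℝ) / 2 ^ k)) := by
  simp [blockSum]

lemma dyadicIndices_div (k i j : ℕ) :
    dyadicIndices (k + i) ((j : ℝ) / 2 ^ k) = Finset.range (j * 2 ^ i) := by
  rw [dyadicIndices, pow_add, ← mul_assoc, div_mul_cancel₀ _ (by positivity)]
  congr 1
  exact_mod_cast Nat.floor_natCast (R := ℝ) (j * 2 ^ i)

lemma tendsto_blockSum {x w : ℝ → ℝ} {k j : ℕ} {I I' : ℝ}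
    (h : HasYoungIntegral x w ((j : ℝ) / 2 ^ k) I)
    (h' : HasYoungIntegral x w (((j : ℝ) + 1) / 2 ^ k) I') :
    Tendsto (fun i => blockSum x w k i j) atTop (𝓝 (I' - I)) := by
  have hk : Tendsto (fun i : ℕ => k + i) atTop atTop := by
    simpa only [add_comm k] using tendsto_add_atTop_nat k
  have h1 := (h'.comp hk).sub (h.comp hk)
  refine h1.congr fun i => ?_
  have e := dyadicIndices_div k i (j + 1)
  push_cast at e
  simp only [Function.comp]
  rw [e, dyadicIndices_div, Nat.succ_mul, Finset.sum_range_add, add_sub_cancel_left]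
  rfl

/-- Halving the mesh changes a left-point sum only through the right halves of the intervals. -/
lemma blockSum_succ_sub (x w : ℝ → ℝ) (k i j : ℕ) :
    blockSum x w k (i + 1) j - blockSum x w k i j = ∑ l ∈ Finset.range (2 ^ i),
      (x ((((j * 2 ^ i + l) * 2 + 1 : ℕ) : ℝ) / 2 ^ (k + i + 1)) -
        x (((j * 2 ^ i + l : ℕ) : ℝ) / 2 ^ (k + i))) *
      (w (((((j * 2 ^ i + l) * 2 + 1 : ℕ) : ℝ) + 1) / 2 ^ (k + i + 1)) -
        w ((((j * 2 ^ i + l) * 2 + 1 : ℕ) : ℝ) / 2 ^ (k + i + 1))) := by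
  rw [blockSum, blockSum, pow_succ 2 i, sum_range_mul_eq, ← Finset.sum_sub_distrib]
  refine Finset.sum_congr rfl fun l _ => ?_
  rw [Finset.sum_range_succ, Finset.sum_range_one]
  have e0 : ((j * (2 ^ i * 2) + (l * 2 + 0) : ℕ) : ℝ) / 2 ^ (k + (i + 1))
      = ((j * 2 ^ i + l : ℕ) : ℝ) / 2 ^ (k + i) := by
    push_cast; field_simp; ring
  have e1 : (((j * (2 ^ i * 2) + (l * 2 + 0) : ℕ) : ℝ) + 1) / 2 ^ (k + (i + 1))
      = (((j * 2 ^ i + l) * 2 + 1 : ℕ) : ℝ) / 2 ^ (k + i + 1) := by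
    push_cast; field_simp; ring
  have e2 : ((j * (2 ^ i * 2) + (l * 2 + 1) : ℕ) : ℝ) / 2 ^ (k + (i + 1))
      = (((j * 2 ^ i + l) * 2 + 1 : ℕ) : ℝ) / 2 ^ (k + i + 1) := by
    push_cast; field_simp; ring
  have e3 : (((j * (2 ^ i * 2) + (l * 2 + 1) : ℕ) : ℝ) + 1) / 2 ^ (k + (i + 1))
      = ((((j * 2 ^ i + l) * 2 + 1 : ℕ) : ℝ) + 1) / 2 ^ (k + i + 1) := by
    push_cast; field_simp; ring
  have e4 : (((j * 2 ^ i + l : ℕ) : ℝ) + 1) / 2 ^ (k + i)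
      = ((((j * 2 ^ i + l) * 2 + 1 : ℕ) : ℝ) + 1) / 2 ^ (k + i + 1) := by
    push_cast; field_simp; ring
  rw [e0, e1, e2, e3, e4]
  ring

/-- The change of the left-point sums under one refinement, in `ℓ²` over all intervals. The
Cauchy–Schwarz inequality on each block costs a factor `2 ^ i`; the squared increments of `w` that
remain are part of its square variation at the finer level. -/
lemma sum_sq_blockSum_succ_sub_le {x w : ℝ → ℝ} {C γ t : ℝ}
    (hx : ∀ r ∈ Set.Icc 0 t, ∀ s ∈ Set.Icc 0 t, |x s - x r| ≤ C * |s - r| ^ γ) (k i : ℕ) :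
    ∑ j ∈ dyadicIndices k t, (blockSum x w k (i + 1) j - blockSum x w k i j) ^ 2
      ≤ 2 ^ i * (C * (((2 : ℝ) ^ (k + i + 1))⁻¹) ^ γ) ^ 2 * dyadicVariation w t (k + i + 1) := by
  set n := ⌊t * 2 ^ k⌋₊ with hn
  set K : ℝ := (C * (((2 : ℝ) ^ (k + i + 1))⁻¹) ^ γ) ^ 2 with hK
  set d : ℕ → ℝ := fun r =>
    (w (((r : ℝ) + 1) / 2 ^ (k + i + 1)) - w ((r : ℝ) / 2 ^ (k + i + 1))) ^ 2
    with hd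
  rcases Nat.eq_zero_or_pos n with hn0 | hnpos
  · rw [dyadicIndices, ← hn, hn0, Finset.range_zero, Finset.sum_empty]
    have : 0 ≤ dyadicVariation w t (k + i + 1) := Finset.sum_nonneg fun _ _ => sq_nonneg _
    positivity
  have ht : (n : ℝ) ≤ t * 2 ^ k := (Nat.le_floor_iff' hnpos.ne').1 le_rfl
  have hterm : ∀ j ∈ Finset.range n, (blockSum x w k (i + 1) j - blockSum x w k i j) ^ 2
      ≤ 2 ^ i * ∑ l ∈ Finset.range (2 ^ i), K * d ((j * 2 ^ i + l) * 2 + 1) := by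
    intro j hj
    rw [blockSum_succ_sub]
    refine sq_sum_le_card_mul_sum_sq.trans ?_
    rw [Finset.card_range]
    push_cast
    gcongr with l hl
    rw [mul_pow]
    simp only [hd]
    push_cast
    gcongr ?_ * _
    rw [hK, ← sq_abs]
    have hq : ((j * 2 ^ i + l : ℕ) : ℝ) + 1 ≤ n * 2 ^ i := by
      have h1 := Finset.mem_range.1 hj
      have h2 := Finset.mem_range.1 hl
      have : j * 2 ^ i + l + 1 ≤ n * 2 ^ i := calc
        j * 2 ^ i + l + 1 ≤ (j + 1) * 2 ^ i := by rw [Nat.succ_mul]; omega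
        _ ≤ n * 2 ^ i := Nat.mul_le_mul_right _ h1
      exact_mod_cast this
    have hq2 : ((j * 2 ^ i + l : ℕ) : ℝ) + 1 ≤ t * 2 ^ (k + i) := by
      refine hq.trans ?_
      rw [pow_add, ← mul_assoc]
      gcongr
    have b1 : ((j * 2 ^ i + l : ℕ) : ℝ) / 2 ^ (k + i) ≤ t := by
      rw [div_le_iff₀ (by positivity)]; linarith
    have b2 : (((j : ℝ) * 2 ^ i + l) * 2 + 1) / 2 ^ (k + i + 1) ≤ t := by
      rw [div_le_iff₀ (by positivity), pow_succ]
      push_cast at hq2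
      linarith
    have key := hx (((j * 2 ^ i + l : ℕ) : ℝ) / 2 ^ (k + i)) ⟨by positivity, b1⟩
      ((((j : ℝ) * 2 ^ i + l) * 2 + 1) / 2 ^ (k + i + 1)) ⟨by positivity, b2⟩
    have e : (((j : ℝ) * 2 ^ i + l) * 2 + 1) / 2 ^ (k + i + 1)
        - ((j * 2 ^ i + l : ℕ) : ℝ) / 2 ^ (k + i) = ((2 : ℝ) ^ (k + i + 1))⁻¹ := by
      push_cast; field_simp; ring
    rw [e, abs_of_nonneg (by positivity : (0 : ℝ) ≤ ((2 : ℝ) ^ (k + i + 1))⁻¹)] at key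
    push_cast at key
    exact pow_le_pow_left₀ (abs_nonneg _) key 2
  calc ∑ j ∈ dyadicIndices k t, (blockSum x w k (i + 1) j - blockSum x w k i j) ^ 2
      ≤ ∑ j ∈ Finset.range n, 2 ^ i * ∑ l ∈ Finset.range (2 ^ i),
          K * d ((j * 2 ^ i + l) * 2 + 1) := Finset.sum_le_sum hterm
    _ = 2 ^ i * K * ∑ q ∈ Finset.range (n * 2 ^ i), d (q * 2 + 1) := by
        rw [sum_range_mul_eq, ← Finset.mul_sum, mul_assoc]
        simp_rw [← Finset.mul_sum]
    _ ≤ 2 ^ i * K * ∑ r ∈ Finset.range (n * 2 ^ i * 2), d r := by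
        rw [sum_range_mul_eq d]
        gcongr with q
        rw [Finset.sum_range_succ, Finset.sum_range_one]
        have : 0 ≤ d (q * 2 + 0) := sq_nonneg _
        linarith
    _ ≤ 2 ^ i * K * dyadicVariation w t (k + i + 1) := by
        have : dyadicVariation w t (k + i + 1) = ∑ r ∈ dyadicIndices (k + i + 1) t, d r := by
          simp [dyadicVariation, hd]
        rw [this]
        gcongr ?_ * ?_
        refine Finset.sum_le_sum_of_subset_of_nonneg ?_ fun _ _ _ => sq_nonneg _
        · refine Finset.range_subset_range.2 (Nat.le_floor ?_)
          push_cast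
          rw [pow_succ, pow_add, ← mul_assoc, ← mul_assoc]
          gcongr

/-- The Young integral over the dyadic intervals of level `k` against its one-point approximation,
in `ℓ²` over all intervals: the refinements contribute a geometric series of ratio
`2 ^ (1 - γ - H)`. -/
lemma exists_sum_sq_young_remainder_le {x w : ℝ → ℝ} {C γ H B t : ℝ} (hγH : 1 < γ + H)
    (hB : ∀ k, ((2 : ℝ) ^ (2 * H - 1)) ^ k * dyadicVariation w t k ≤ B)
    (hx : ∀ r ∈ Set.Icc 0 t, ∀ s ∈ Set.Icc 0 t, |x s - x r| ≤ C * |s - r| ^ γ) :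
    ∃ K, ∀ (k : ℕ) (Y : ℕ → ℝ),
      (∀ j ∈ dyadicIndices k t, Tendsto (fun i => blockSum x w k i j) atTop (𝓝 (Y j))) →
      ∑ j ∈ dyadicIndices k t, (Y j - x ((j : ℝ) / 2 ^ k) *
        (w (((j : ℝ) + 1) / 2 ^ k) - w ((j : ℝ) / 2 ^ k))) ^ 2 ≤ K * (1 / 2) ^ k := by
  set ρ : ℝ := (2 : ℝ) ^ (1 - γ - H) with hρ
  have hρ0 : 0 < ρ := by positivity
  have hρ1 : ρ < 1 := Real.rpow_lt_one_of_one_lt_of_neg (by norm_num) (by linarith)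
  have hB0 : 0 ≤ B := le_trans (mul_nonneg (by positivity)
    (Finset.sum_nonneg fun _ _ => sq_nonneg _)) (hB 0)
  refine ⟨(|C| * √B / (1 - ρ)) ^ 2, fun k Y hY => ?_⟩
  set n := ⌊t * 2 ^ k⌋₊ with hn
  set S : ℕ → EuclideanSpace ℝ (Fin n) := fun i => WithLp.toLp 2 fun j => blockSum x w k i j with hS
  have hlim : Tendsto S atTop (𝓝 (WithLp.toLp 2 fun j : Fin n => Y j)) :=
    ((PiLp.continuous_toLp 2 _).tendsto _).comp
      (tendsto_pi_nhds.2 fun j => hY j (Finset.mem_range.2 j.2))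
  have hstep : ∀ i, dist (S i) (S (i + 1)) ≤ |C| * √B * √((1 / 2) ^ k) * ρ ^ i := fun i => by
    rw [dist_comm, dist_eq_norm]
    refine (sq_le_sq₀ (norm_nonneg _) (by positivity)).1 ?_
    rw [EuclideanSpace.norm_sq_eq]
    have e1 : ∑ j : Fin n, ‖(S (i + 1) - S i) j‖ ^ 2
        = ∑ j ∈ dyadicIndices k t, (blockSum x w k (i + 1) j - blockSum x w k i j) ^ 2 := by
      rw [dyadicIndices, ← hn, Finset.sum_range]
      simp [hS]
    rw [e1]
    refine (sum_sq_blockSum_succ_sub_le hx k i).trans ?_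
    set m := k + i + 1 with hm
    have e2 : (((2 : ℝ) ^ m)⁻¹ ^ γ) ^ 2 = ((2 : ℝ) ^ (2 * H - 1)) ^ m * (ρ ^ 2 / 2) ^ m := by
      rw [inv_two_pow_rpow, ← pow_mul, mul_comm m 2, pow_mul, ← mul_pow]
      congr 1
      rw [hρ, ← Real.rpow_natCast, ← Real.rpow_natCast, ← Real.rpow_mul (by norm_num),
        ← Real.rpow_mul (by norm_num), div_eq_mul_inv, ← Real.rpow_neg_one,
        ← Real.rpow_add (by norm_num), ← Real.rpow_add (by norm_num)]
      congr 1; push_cast; ring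
    -- The factors 1/2 of levels `k + 1, …, k + i` will absorb the `2 ^ i` from Cauchy–Schwarz.
    have e3 : (ρ ^ 2 / 2) ^ m ≤ (1 / 2) ^ k * (ρ ^ 2 / 2) ^ i := by
      have h1 : ρ ^ 2 ≤ 1 := pow_le_one₀ hρ0.le hρ1.le
      have h2 : ρ ^ 2 / 2 ≤ 1 / 2 := by linarith
      have h3 : (ρ ^ 2 / 2) ^ (k + i + 1) ≤ (ρ ^ 2 / 2) ^ (k + i) :=
        pow_le_pow_of_le_one (by positivity) (by linarith) (Nat.le_succ _)
      refine h3.trans ?_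
      rw [pow_add]
      gcongr
    calc 2 ^ i * (C * ((2 : ℝ) ^ m)⁻¹ ^ γ) ^ 2 * dyadicVariation w t m
        = 2 ^ i * C ^ 2 * (ρ ^ 2 / 2) ^ m *
          (((2 : ℝ) ^ (2 * H - 1)) ^ m * dyadicVariation w t m) := by
          rw [mul_pow, e2]; ring
      _ ≤ 2 ^ i * C ^ 2 * ((1 / 2) ^ k * (ρ ^ 2 / 2) ^ i) * B := by
          gcongr
          · exact mul_nonneg (by positivity) (Finset.sum_nonneg fun _ _ => sq_nonneg _)
          · exact hB m
      _ = (|C| * √B * √((1 / 2) ^ k) * ρ ^ i) ^ 2 := by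
          rw [mul_pow, mul_pow, mul_pow, Real.sq_sqrt hB0, Real.sq_sqrt (by positivity), sq_abs,
            one_div_pow]
          have : (2 : ℝ) ^ i * (ρ ^ 2 / 2) ^ i = (ρ ^ i) ^ 2 := by
            rw [← mul_pow, ← pow_mul, mul_comm i 2, pow_mul]; congr 1; ring
          rw [← this]
          ring
  have hfin := dist_le_of_le_geometric_of_tendsto₀ ρ _ hρ1 hstep hlim
  rw [dist_comm, dist_eq_norm] at hfin
  have h1 := pow_le_pow_left₀ (norm_nonneg _) hfin 2
  rw [EuclideanSpace.norm_sq_eq] at h1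
  have e : ∑ j ∈ dyadicIndices k t, (Y j - x ((j : ℝ) / 2 ^ k) *
        (w (((j : ℝ) + 1) / 2 ^ k) - w ((j : ℝ) / 2 ^ k))) ^ 2
      = ∑ j : Fin n,
        ‖((WithLp.toLp 2 fun j : Fin n => Y j) - S 0 : EuclideanSpace ℝ (Fin n)) j‖ ^ 2 := by
    rw [dyadicIndices, ← hn, Finset.sum_range]
    simp [hS, blockSum_zero]
  rw [e]
  refine h1.trans (le_of_eq ?_)
  rw [show |C| * √B * √((1 / 2) ^ k) / (1 - ρ) = |C| * √B / (1 - ρ) * √((1 / 2) ^ k) by ring,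
    mul_pow, Real.sq_sqrt (by positivity)]

lemma continuousOn_of_norm_sub_le {V : Type*} [NormedAddCommGroup V] {y : ℝ → V} {C γ : ℝ}
    {s : Set ℝ} (hγ : 0 < γ)
    (h : ∀ r ∈ s, ∀ t ∈ s, ‖y t - y r‖ ≤ C * |t - r| ^ γ) : ContinuousOn y s := by
  intro r hr
  rw [ContinuousWithinAt, tendsto_iff_norm_sub_tendsto_zero]
  have h1 : Tendsto (fun t => C * |t - r| ^ γ) (𝓝[s] r) (𝓝 0) := by
    have : ContinuousAt (fun t => C * |t - r| ^ γ) r :=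
      continuousAt_const.mul ((by fun_prop : ContinuousAt (fun t => |t - r|) r).rpow_const
        (Or.inr hγ.le))
    have h2 := this.tendsto
    simp only [sub_self, abs_zero, Real.zero_rpow hγ.ne', mul_zero] at h2
    exact h2.mono_left nhdsWithin_le_nhds
  refine squeeze_zero' (Eventually.of_forall fun _ => norm_nonneg _) ?_ h1
  filter_upwards [self_mem_nhdsWithin] with t ht
  exact h r hr t ht

/-- Square sums of families whose difference is negligible in `ℓ²` have the same limit. -/
lemma tendsto_sum_sq_of_sub {s : ℕ → Finset ℕ} {a : ℕ → ℝ} {u v : ℕ → ℕ → ℝ}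
    {I : ℝ} (hu : Tendsto (fun k => a k * ∑ j ∈ s k, u k j ^ 2) atTop (𝓝 I))
    (hv : Tendsto (fun k => a k * ∑ j ∈ s k, (v k j - u k j) ^ 2) atTop (𝓝 0)) :
    Tendsto (fun k => a k * ∑ j ∈ s k, v k j ^ 2) atTop (𝓝 I) := by
  have hcross : Tendsto (fun k => a k * ∑ j ∈ s k, u k j * (v k j - u k j)) atTop (𝓝 0) := by
    have h1 := (hu.mul hv).sqrt
    rw [mul_zero, Real.sqrt_zero] at h1
    refine squeeze_zero_norm (fun k => ?_) h1
    rw [Real.norm_eq_abs]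
    refine Real.abs_le_sqrt ?_
    have := Finset.sum_mul_sq_le_sq_mul_sq (s k) (u k) (fun j => v k j - u k j)
    rw [mul_pow, show a k * ∑ j ∈ s k, u k j ^ 2 = a k * ∑ j ∈ s k, u k j ^ 2 from rfl]
    calc a k ^ 2 * (∑ j ∈ s k, u k j * (v k j - u k j)) ^ 2
        ≤ a k ^ 2 * ((∑ j ∈ s k, u k j ^ 2) * ∑ j ∈ s k, (v k j - u k j) ^ 2) := by gcongr
      _ = _ := by ring
  have h := (hu.add (hcross.const_mul 2)).add hv
  simp only [mul_zero, add_zero] at h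
  refine h.congr fun k => ?_
  have e : ∀ j, v k j ^ 2 = u k j ^ 2 + 2 * (u k j * (v k j - u k j)) + (v k j - u k j) ^ 2 :=
    fun j => by ring
  simp_rw [e, Finset.sum_add_distrib, ← Finset.mul_sum]
  ring

/-- The rescaled dyadic square variation of a path `X = X 0 + ∫ D ds + ∫ x dw` converges to
`∫ x² ds`, as soon as the one of `w` converges to `s` on `[0, s]`. -/
theorem tendsto_dyadicVariation_of_hasYoungIntegral {x w X D : ℝ → ℝ} {C γ H t : ℝ} (ht : 0 < t)
    (hγ : 0 < γ) (hγH : 1 < γ + H) (hH1 : H < 1)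
    (hw : ∀ N i : ℕ, Tendsto (fun k => ((2 : ℝ) ^ (2 * H - 1)) ^ k *
      dyadicVariation w (t * i / N) k) atTop (𝓝 (t * i / N)))
    (hx : ∀ r ∈ Set.Icc 0 t, ∀ s ∈ Set.Icc 0 t, |x s - x r| ≤ C * |s - r| ^ γ)
    (hD : ContinuousOn D (Set.Icc 0 t))
    (hX : ∀ k j : ℕ, (j : ℝ) / 2 ^ k ≤ t → HasYoungIntegral x w ((j : ℝ) / 2 ^ k)
      (X ((j : ℝ) / 2 ^ k) - X 0 - ∫ s in (0 : ℝ)..(j : ℝ) / 2 ^ k, D s)) :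
    Tendsto (fun k => ((2 : ℝ) ^ (2 * H - 1)) ^ k * dyadicVariation X t k) atTop
      (𝓝 (∫ s in (0 : ℝ)..t, x s ^ 2)) := by
  set a : ℝ := (2 : ℝ) ^ (2 * H - 1)
  have ha0 : 0 < a := by positivity
  have hxc : ContinuousOn x (Set.Icc 0 t) := continuousOn_of_norm_sub_le hγ hx
  have hwt : Tendsto (fun k => a ^ k * dyadicVariation w t k) atTop (𝓝 t) := by
    simpa using hw 1 1
  obtain ⟨B, hB⟩ := hwt.bddAbove_range
  have hB : ∀ k, a ^ k * dyadicVariation w t k ≤ B := fun k => hB ⟨k, rfl⟩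
  obtain ⟨K, hK⟩ := exists_sum_sq_young_remainder_le hγH hB hx
  obtain ⟨M, hM⟩ := isCompact_Icc.exists_bound_of_continuousOn hD
  set δ : ℕ → ℕ → ℝ := fun k j => w (((j : ℝ) + 1) / 2 ^ k) - w ((j : ℝ) / 2 ^ k) with hδ
  have hmain : Tendsto (fun k => a ^ k * ∑ j ∈ dyadicIndices k t,
      (x ((j : ℝ) / 2 ^ k) * δ k j) ^ 2) atTop (𝓝 (∫ s in (0 : ℝ)..t, x s ^ 2)) := by
    have h := tendsto_sum_mul_of_tendsto_sum (c := fun k j => a ^ k * δ k j ^ 2)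
      (fun k j => by positivity) ht (fun N i => by
        refine (hw N i).congr fun k => ?_
        simp [dyadicVariation, hδ, Finset.mul_sum]) (f := fun s => x s ^ 2) (hxc.pow 2)
    refine h.congr fun k => ?_
    rw [Finset.mul_sum]
    exact Finset.sum_congr rfl fun j _ => by ring
  have hrem : ∀ k, ∑ j ∈ dyadicIndices k t,
      ((X (((j : ℝ) + 1) / 2 ^ k) - X ((j : ℝ) / 2 ^ k)) - x ((j : ℝ) / 2 ^ k) * δ k j) ^ 2
        ≤ (2 * K + 2 * (M ^ 2 * t)) * (1 / 2) ^ k := by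
    intro k
    have hp : (0 : ℝ) < 2 ^ k := by positivity
    have hle : ∀ j ∈ dyadicIndices k t, ((j : ℝ) + 1) / 2 ^ k ≤ t := fun j hj =>
      mem_dyadicIndices.1 hj
    have hlt : ∀ j : ℕ, (j : ℝ) / 2 ^ k ≤ ((j : ℝ) + 1) / 2 ^ k := fun j => by
      gcongr; linarith
    have hDi : ∀ b ∈ Set.Icc 0 t, IntervalIntegrable D volume 0 b := fun b hb =>
      (hD.mono (by
        rw [Set.uIcc_of_le hb.1]
        exact Set.Icc_subset_Icc_right hb.2)).intervalIntegrable
    set d : ℕ → ℝ := fun j => ∫ s in (j : ℝ) / 2 ^ k..((j : ℝ) + 1) / 2 ^ k, D s with hd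
    have hdb : ∀ j ∈ dyadicIndices k t, d j ^ 2 ≤ M ^ 2 * ((1 / 2) ^ k * (1 / 2) ^ k) := by
      intro j hj
      have h1 := intervalIntegral.norm_integral_le_of_norm_le_const (a := (j : ℝ) / 2 ^ k)
        (b := ((j : ℝ) + 1) / 2 ^ k) (C := M) (f := D) fun r hr => by
          rw [Set.uIoc_of_le (hlt j)] at hr
          have h0 : (0 : ℝ) ≤ (j : ℝ) / 2 ^ k := by positivity
          exact hM r ⟨h0.trans hr.1.le, hr.2.trans (hle j hj)⟩
      rw [← sub_div, add_sub_cancel_left, abs_of_nonneg (by positivity), Real.norm_eq_abs] at h1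
      have h2 := pow_le_pow_left₀ (abs_nonneg _) h1 2
      rw [sq_abs] at h2
      refine h2.trans (le_of_eq ?_)
      rw [one_div_pow]; ring
    have hdsum : ∑ j ∈ dyadicIndices k t, d j ^ 2 ≤ M ^ 2 * t * (1 / 2) ^ k := by
      refine (Finset.sum_le_sum hdb).trans ?_
      rw [Finset.sum_const, dyadicIndices, Finset.card_range, nsmul_eq_mul]
      have h1 : (⌊t * 2 ^ k⌋₊ : ℝ) ≤ t * 2 ^ k := Nat.floor_le (by positivity)
      calc (⌊t * 2 ^ k⌋₊ : ℝ) * (M ^ 2 * ((1 / 2) ^ k * (1 / 2) ^ k))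
          ≤ t * 2 ^ k * (M ^ 2 * ((1 / 2) ^ k * (1 / 2) ^ k)) := by gcongr
        _ = M ^ 2 * t * (1 / 2) ^ k := by rw [one_div_pow]; field_simp
    set Y : ℕ → ℝ := fun j => X (((j : ℝ) + 1) / 2 ^ k) - X ((j : ℝ) / 2 ^ k) - d j with hY
    have hYlim : ∀ j ∈ dyadicIndices k t,
        Tendsto (fun i => blockSum x w k i j) atTop (𝓝 (Y j)) := by
      intro j hj
      have h1 := hX k (j + 1) (by push_cast; exact hle j hj)
      push_cast at h1
      have h2 := tendsto_blockSum (hX k j ((hlt j).trans (hle j hj))) h1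
      convert! h2 using 2
      have h3 := intervalIntegral.integral_interval_sub_left
        (hDi (((j : ℝ) + 1) / 2 ^ k) ⟨by positivity, hle j hj⟩)
        (hDi ((j : ℝ) / 2 ^ k) ⟨by positivity, (hlt j).trans (hle j hj)⟩)
      simp only [hY, hd]
      rw [← h3]
      ring
    have h4 := hK k Y hYlim
    calc ∑ j ∈ dyadicIndices k t,
          ((X (((j : ℝ) + 1) / 2 ^ k) - X ((j : ℝ) / 2 ^ k)) - x ((j : ℝ) / 2 ^ k) * δ k j) ^ 2
        ≤ ∑ j ∈ dyadicIndices k t,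
          (2 * (Y j - x ((j : ℝ) / 2 ^ k) * δ k j) ^ 2 + 2 * d j ^ 2) := by
          refine Finset.sum_le_sum fun j _ => ?_
          have : X (((j : ℝ) + 1) / 2 ^ k) - X ((j : ℝ) / 2 ^ k) = Y j + d j := by
            simp only [hY]; ring
          rw [this]
          nlinarith [sq_nonneg (Y j - x ((j : ℝ) / 2 ^ k) * δ k j - d j)]
      _ ≤ 2 * (K * (1 / 2) ^ k) + 2 * (M ^ 2 * t * (1 / 2) ^ k) := by
          rw [Finset.sum_add_distrib, ← Finset.mul_sum, ← Finset.mul_sum]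
          gcongr
      _ = _ := by ring
  have hneg : Tendsto (fun k => a ^ k * ∑ j ∈ dyadicIndices k t,
      ((X (((j : ℝ) + 1) / 2 ^ k) - X ((j : ℝ) / 2 ^ k)) - x ((j : ℝ) / 2 ^ k) * δ k j) ^ 2)
      atTop (𝓝 0) := by
    have ha2 : a / 2 < 1 := by
      have : a < 2 := by
        calc a < (2 : ℝ) ^ (1 : ℝ) := Real.rpow_lt_rpow_of_exponent_lt (by norm_num) (by linarith)
          _ = 2 := Real.rpow_one 2
      linarith
    have h1 := (tendsto_pow_atTop_nhds_zero_of_lt_one (by positivity) ha2).const_mul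
      (2 * K + 2 * (M ^ 2 * t))
    rw [mul_zero] at h1
    refine squeeze_zero (fun k => by positivity) (fun k => ?_) h1
    calc _ ≤ a ^ k * ((2 * K + 2 * (M ^ 2 * t)) * (1 / 2) ^ k) := by
          gcongr
          exact hrem k
      _ = _ := by rw [one_div_pow, div_pow]; ring
  have := tendsto_sum_sq_of_sub (a := fun k => a ^ k) hmain hneg
  refine this.congr fun k => ?_
  simp [dyadicVariation]

/-! ### Smooth functions on the torus -/

section Smooth

variable {E F : Type*} [NormedAddCommGroup E] [NormedSpace ℝ E]
  [NormedAddCommGroup F] [NormedSpace ℝ F]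

lemma isOpenQuotientMap_coe :
    IsOpenQuotientMap (fun (x : Fin 2 → ℝ) (i : Fin 2) => (x i : UnitAddCircle)) :=
  IsOpenQuotientMap.piMap fun _ => QuotientAddGroup.isOpenQuotientMap_mk

lemma exists_lift (x : Torus) : ∃ y : Fin 2 → ℝ, (fun i => (y i : UnitAddCircle)) = x :=
  isOpenQuotientMap_coe.surjective x

lemma coe_add_smul_single (y : Fin 2 → ℝ) (i : Fin 2) (h : ℝ) :
    (fun j => ((y + h • Pi.single i (1 : ℝ) : Fin 2 → ℝ) j : UnitAddCircle))
      = (fun j => (y j : UnitAddCircle)) + Pi.single i (h : UnitAddCircle) := by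
  ext j
  by_cases hj : j = i
  · subst hj; simp
  · simp [hj]

namespace IsSmooth

variable {φ : Torus → E}

protected lemma continuous (hφ : IsSmooth φ) : Continuous φ :=
  isOpenQuotientMap_coe.continuous_comp_iff.1 (ContDiff.continuous hφ)

lemma hasDerivAt (hφ : IsSmooth φ) (i : Fin 2) (y : Fin 2 → ℝ) :
    HasDerivAt (fun h : ℝ => φ ((fun j => (y j : UnitAddCircle)) + Pi.single i (h : UnitAddCircle)))
      (fderiv ℝ (fun x : Fin 2 → ℝ => φ fun i => (x i : UnitAddCircle)) y (Pi.single i 1)) 0 := by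
  have h1 := ((ContDiff.differentiable hφ (by simp)) y).hasFDerivAt
  have h2 : HasDerivAt (fun h : ℝ => y + h • (Pi.single i 1 : Fin 2 → ℝ)) (Pi.single i 1) 0 := by
    simpa using ((hasDerivAt_id (0 : ℝ)).smul_const (Pi.single i 1 : Fin 2 → ℝ)).const_add y
  have h3 := h1.comp_hasDerivAt_of_eq (0 : ℝ) h2 (by simp)
  refine h3.congr_of_eventuallyEq (Eventually.of_forall fun h => ?_)
  simp only [Function.comp, coe_add_smul_single]

/-- On lifts to `ℝ²` the partial derivatives are the usual ones. -/
lemma pderiv_coe (hφ : IsSmooth φ) (i : Fin 2) (y : Fin 2 → ℝ) :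
    pderiv i φ (fun j => (y j : UnitAddCircle))
      = fderiv ℝ (fun x : Fin 2 → ℝ => φ fun i => (x i : UnitAddCircle)) y (Pi.single i 1) :=
  (hφ.hasDerivAt i y).deriv

protected lemma pderiv (hφ : IsSmooth φ) (i : Fin 2) : IsSmooth (pderiv i φ) := by
  rw [IsSmooth]
  simp_rw [hφ.pderiv_coe]
  have h : ContDiff ℝ ((⊤ : ℕ∞) : WithTop ℕ∞)
      (fderiv ℝ fun x : Fin 2 → ℝ => φ fun i => (x i : UnitAddCircle)) :=
    ContDiff.fderiv_right hφ (by simp)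
  exact h.clm_apply contDiff_const

protected lemma laplacian (hφ : IsSmooth φ) : IsSmooth (laplacian φ) :=
  ContDiff.sum fun i _ => (hφ.pderiv i).pderiv i

protected lemma transport {ξ : Fin 2 → Torus → ℝ} (hξ : ∀ i, IsSmooth (ξ i)) (hφ : IsSmooth φ) :
    IsSmooth (transport ξ φ) :=
  ContDiff.sum fun i _ => ContDiff.smul (hξ i) (hφ.pderiv i)

lemma clm_comp (L : E →L[ℝ] F) (hφ : IsSmooth φ) : IsSmooth fun x => L (φ x) :=
  L.contDiff.comp hφ

lemma pderiv_clm_comp (L : E →L[ℝ] F) (hφ : IsSmooth φ) (i : Fin 2) :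
    pderiv i (fun x => L (φ x)) = fun x => L (pderiv i φ x) := by
  ext x
  obtain ⟨y, rfl⟩ := exists_lift x
  rw [hφ.pderiv_coe]
  exact (L.hasFDerivAt.comp_hasDerivAt (0 : ℝ) (hφ.hasDerivAt i y)).deriv

lemma transport_clm_comp (L : E →L[ℝ] F) (hφ : IsSmooth φ) (v : Fin 2 → Torus → ℝ) :
    transport v (fun x => L (φ x)) = fun x => L (transport v φ x) := by
  ext x
  simp only [transport, hφ.pderiv_clm_comp, map_sum, map_smul]

end IsSmooth

end Smooth

/-! ### Pairings as bounded functionals -/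

lemma memLp_of_continuous {E : Type*} [NormedAddCommGroup E] {ψ : Torus → E} (hψ : Continuous ψ)
    (p : ℝ≥0∞) : MemLp ψ p torusMeasure :=
  hψ.memLp_of_hasCompactSupport (HasCompactSupport.of_compactSpace ψ)

section Pairing

variable {E F : Type*} [NormedAddCommGroup E] [NormedSpace ℝ E]
  [NormedAddCommGroup F] [NormedSpace ℝ F]

lemma integrable_smul_of_continuous (f : L2) {ψ : Torus → E} (hψ : Continuous ψ) :
    Integrable (fun x => f x • ψ x) torusMeasure :=
  memLp_one_iff_integrable.1 ((memLp_of_continuous hψ 2).smul (Lp.memLp f))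

/-- The pairing with a continuous function is a bounded linear functional on `L²`. -/
lemma exists_clm_eq_pairing [CompleteSpace E] {ψ : Torus → E} (hψ : Continuous ψ) :
    ∃ L : L2 →L[ℝ] E, ∀ f, L f = pairing f ψ := by
  refine ⟨((ContinuousLinearMap.lsmul ℝ ℝ).lpPairing torusMeasure 2 2).flip
    ((memLp_of_continuous hψ 2).toLp ψ), fun f => ?_⟩
  rw [ContinuousLinearMap.flip_apply, ContinuousLinearMap.lpPairing_eq_integral]
  refine integral_congr_ae ?_
  filter_upwards [(memLp_of_continuous hψ 2).coeFn_toLp] with x hx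
  rw [hx]
  rfl

lemma pairing_sub [CompleteSpace E] (f g : L2) {ψ : Torus → E} (hψ : Continuous ψ) :
    pairing (f - g) ψ = pairing f ψ - pairing g ψ := by
  obtain ⟨L, hL⟩ := exists_clm_eq_pairing hψ
  simp only [← hL, map_sub]

lemma pairing_clm_comp [CompleteSpace E] [CompleteSpace F] (L : E →L[ℝ] F) (f : L2)
    {ψ : Torus → E} (hψ : Continuous ψ) : pairing f (fun x => L (ψ x)) = L (pairing f ψ) := by
  rw [pairing, pairing, ← L.integral_comp_comm (integrable_smul_of_continuous f hψ)]
  simp only [map_smul]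

/-- `(f, g) ↦ ∫ f g ψ` is a bounded bilinear form on `L²` for continuous `ψ`. -/
lemma exists_clm_eq_integral_mul {ψ : Torus → ℝ} (hψ : Continuous ψ) :
    ∃ B : L2 →L[ℝ] L2 →L[ℝ] ℝ, ∀ f g : L2,
      Integrable (fun x => f x * (g x * ψ x)) torusMeasure ∧
      B f g = ∫ x, f x * (g x * ψ x) ∂torusMeasure := by
  set M : L2 →L[ℝ] L2 := ((ContinuousLinearMap.mul ℝ ℝ).holderL torusMeasure 2 ∞ 2).flip
    ((memLp_of_continuous hψ ∞).toLp ψ) with hM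
  have hMg : ∀ g : L2, M g =ᵐ[torusMeasure] fun x => g x * ψ x := fun g => by
    have h1 := (ContinuousLinearMap.mul ℝ ℝ).coeFn_holder (r := 2) g
      ((memLp_of_continuous hψ ∞).toLp ψ)
    filter_upwards [h1, (memLp_of_continuous hψ ∞).coeFn_toLp] with x hx hx2
    rw [hx2] at hx
    exact hx
  refine ⟨(((ContinuousLinearMap.mul ℝ ℝ).lpPairing torusMeasure 2 2).flip.comp M).flip,
    fun f g => ⟨?_, ?_⟩⟩
  · refine ((Lp.memLp f).integrable_mul (Lp.memLp (M g))).congr ?_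
    filter_upwards [hMg g] with x hx
    rw [Pi.mul_apply, hx]
  · rw [ContinuousLinearMap.flip_apply, ContinuousLinearMap.comp_apply,
      ContinuousLinearMap.flip_apply, ContinuousLinearMap.lpPairing_eq_integral]
    refine integral_congr_ae ?_
    filter_upwards [hMg g] with x hx
    rw [hx]
    rfl

end Pairing

/-! ### Parseval and Sobolev norms -/

/-- Parseval's identity for real-valued functions. -/
lemma hasSum_sq_mFourierCoeff_ofReal (f : L2) :
    HasSum (fun k : Fin 2 → ℤ =>
      ‖UnitAddTorus.mFourierCoeff (fun x => ((f x : ℝ) : ℂ)) k‖ ^ 2) (‖f‖ ^ 2) := by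
  have hm : MemLp (fun x => ((f x : ℝ) : ℂ)) 2 torusMeasure := (Lp.memLp f).ofReal
  have h := UnitAddTorus.hasSum_sq_mFourierCoeff (d := Fin 2) (hm.toLp _)
  have e1 : ∀ k, UnitAddTorus.mFourierCoeff (hm.toLp _) k
      = UnitAddTorus.mFourierCoeff (fun x => ((f x : ℝ) : ℂ)) k := fun k =>
    integral_congr_ae (by
      filter_upwards [hm.coeFn_toLp] with x hx
      rw [hx])
  simp_rw [e1] at h
  convert! h using 1
  rw [← real_inner_self_eq_norm_sq, L2.inner_def]
  refine integral_congr_ae ?_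
  filter_upwards [hm.coeFn_toLp] with x hx
  rw [hx]
  simp [sq]

lemma ofReal_norm_le_sobolevNorm {s : ℝ} (hs : 0 ≤ s) (f : L2) :
    ENNReal.ofReal ‖f‖ ≤ sobolevNorm s f := by
  have h := hasSum_sq_mFourierCoeff_ofReal f
  have e : ENNReal.ofReal ‖f‖ = (ENNReal.ofReal (‖f‖ ^ 2)) ^ (1 / 2 : ℝ) := by
    rw [ENNReal.ofReal_rpow_of_nonneg (by positivity) (by norm_num), ← Real.sqrt_eq_rpow,
      Real.sqrt_sq (norm_nonneg f)]
  rw [e, sobolevNorm, ← h.tsum_eq, ENNReal.ofReal_tsum_of_nonneg (fun k => by positivity)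
    h.summable]
  refine ENNReal.rpow_le_rpow (ENNReal.tsum_le_tsum fun k => ENNReal.ofReal_le_ofReal ?_)
    (by norm_num)
  refine le_mul_of_one_le_left (by positivity) (Real.one_le_rpow ?_ hs)
  have : 0 ≤ ∑ i, (k i : ℝ) ^ 2 := by positivity
  linarith

lemma HolderInSobolev.exists_norm_sub_le {s γ T : ℝ} {y : ℝ → L2} (hs : 0 ≤ s)
    (h : HolderInSobolev s γ T y) :
    ∃ C : ℝ, 0 ≤ C ∧ ∀ r ∈ Set.Icc 0 T, ∀ t ∈ Set.Icc 0 T, ‖y t - y r‖ ≤ C * |t - r| ^ γ := by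
  obtain ⟨C, hC⟩ := h
  refine ⟨C, C.2, fun r hr t ht => ?_⟩
  have h1 := (ofReal_norm_le_sobolevNorm hs (y t - y r)).trans (hC r hr t ht)
  rw [← ENNReal.ofReal_coe_nnreal, ← ENNReal.ofReal_mul C.coe_nonneg] at h1
  exact (ENNReal.ofReal_le_ofReal_iff (by positivity)).1 h1

/-! ### The Biot–Savart law in Fourier variables -/

lemma isSmooth_mFourier (k : Fin 2 → ℤ) : IsSmooth (UnitAddTorus.mFourier k) := by
  rw [IsSmooth]
  simp only [UnitAddTorus.mFourier, ContinuousMap.coe_mk, fourier_coe_apply]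
  refine contDiff_prod fun i _ => ContDiff.cexp
    (ContDiff.div_const (ContDiff.mul contDiff_const ?_) _)
  exact Complex.ofRealCLM.contDiff.comp (contDiff_apply ℝ ℝ i)

lemma mFourier_add_single (k : Fin 2 → ℤ) (x : Torus) (i : Fin 2) (h : UnitAddCircle) :
    UnitAddTorus.mFourier k (x + Pi.single i h) = UnitAddTorus.mFourier k x * fourier (k i) h := by
  have e : ∀ j, fourier (k j) ((x + Pi.single i h : Torus) j)
      = fourier (k j) (x j) * if j = i then fourier (k i) h else 1 := fun j => by
    by_cases hj : j = i
    · subst hj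
      simp [fourier_apply, AddCircle.toCircle_add, smul_add]
    · simp [hj]
  simp only [UnitAddTorus.mFourier, ContinuousMap.coe_mk]
  simp_rw [e, Finset.prod_mul_distrib, Finset.prod_ite_eq', Finset.mem_univ, if_true]

lemma pderiv_mFourier (k : Fin 2 → ℤ) (i : Fin 2) :
    pderiv i (UnitAddTorus.mFourier k)
      = fun x => (2 * Real.pi * Complex.I * k i) * UnitAddTorus.mFourier k x := by
  ext x
  rw [pderiv]
  simp_rw [mFourier_add_single]
  have h := (hasDerivAt_fourier 1 (k i) 0).const_mul (UnitAddTorus.mFourier k x)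
  rw [h.deriv]
  simp
  ring

lemma pairing_mFourier (f : L2) (k : Fin 2 → ℤ) :
    pairing f (UnitAddTorus.mFourier (-k))
      = UnitAddTorus.mFourierCoeff (fun x => ((f x : ℝ) : ℂ)) k := by
  refine integral_congr_ae (Eventually.of_forall fun x => ?_)
  simp [mul_comm]

lemma pairing_pderiv_mFourier (f : L2) (k : Fin 2 → ℤ) (i : Fin 2) :
    pairing f (pderiv i (UnitAddTorus.mFourier (-k)))
      = -(2 * Real.pi * Complex.I * k i) *
        UnitAddTorus.mFourierCoeff (fun x => ((f x : ℝ) : ℂ)) k := by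
  rw [← pairing_mFourier, pderiv_mFourier, pairing, pairing, ← integral_const_mul]
  refine integral_congr_ae (Eventually.of_forall fun x => ?_)
  simp
  ring

namespace IsVelocityOf

variable {u v : Fin 2 → L2} {w z : L2}

/-- The defining identities of the Biot–Savart law extend to complex test functions, in particular
to the exponentials `mFourier k`. -/
lemma div_free_complex (h : IsVelocityOf u w) {ψ : Torus → ℂ} (hψ : IsSmooth ψ) :
    pairing (u 0) (pderiv 0 ψ) + pairing (u 1) (pderiv 1 ψ) = 0 := by
  have key : ∀ L : ℂ →L[ℝ] ℝ, L (pairing (u 0) (pderiv 0 ψ) + pairing (u 1) (pderiv 1 ψ)) = 0 :=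
    fun L => by
      have h1 := h.div_free _ (hψ.clm_comp L)
      rwa [hψ.pderiv_clm_comp, hψ.pderiv_clm_comp, pairing_clm_comp _ _ (hψ.pderiv 0).continuous,
        pairing_clm_comp _ _ (hψ.pderiv 1).continuous, ← map_add] at h1
  exact Complex.ext (key Complex.reCLM) (key Complex.imCLM)

lemma curl_eq_complex (h : IsVelocityOf u w) {ψ : Torus → ℂ} (hψ : IsSmooth ψ) :
    pairing (u 0) (pderiv 1 ψ) - pairing (u 1) (pderiv 0 ψ) = pairing w ψ := by
  have key : ∀ L : ℂ →L[ℝ] ℝ,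
      L (pairing (u 0) (pderiv 1 ψ) - pairing (u 1) (pderiv 0 ψ)) = L (pairing w ψ) :=
    fun L => by
      have h1 := h.curl_eq _ (hψ.clm_comp L)
      rwa [hψ.pderiv_clm_comp, hψ.pderiv_clm_comp, pairing_clm_comp _ _ (hψ.pderiv 0).continuous,
        pairing_clm_comp _ _ (hψ.pderiv 1).continuous, ← map_sub,
        pairing_clm_comp _ _ hψ.continuous] at h1
  exact Complex.ext (key Complex.reCLM) (key Complex.imCLM)

/-- In Fourier variables the Biot–Savart law reads `k₀ û₀ + k₁ û₁ = 0` and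
`2πi (k₀ û₁ - k₁ û₀) = ŵ`. For `k ≠ 0` this gives `2πi |k|² û = (-k₁, k₀) ŵ`, and `|kᵢ| ≤ |k|²`
since the `kᵢ` are integers; for `k = 0` the mean of `u` vanishes. -/
lemma norm_mFourierCoeff_le (h : IsVelocityOf u w) (i : Fin 2) (k : Fin 2 → ℤ) :
    ‖UnitAddTorus.mFourierCoeff (fun x => ((u i x : ℝ) : ℂ)) k‖
      ≤ ‖UnitAddTorus.mFourierCoeff (fun x => ((w x : ℝ) : ℂ)) k‖ := by
  set a : Fin 2 → ℂ := fun i => UnitAddTorus.mFourierCoeff (fun x => ((u i x : ℝ) : ℂ)) k with ha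
  set b := UnitAddTorus.mFourierCoeff (fun x => ((w x : ℝ) : ℂ)) k with hb
  change ‖a i‖ ≤ ‖b‖
  by_cases hk : k = 0
  · have h0 : a i = 0 := by
      simp only [ha, hk]
      rw [← pairing_mFourier, neg_zero, UnitAddTorus.mFourier_zero, pairing]
      have h1 := h.mean_zero i
      simp only [ContinuousMap.one_apply, Complex.real_smul, mul_one]
      rw [integral_complex_ofReal, h1]
      simp
    rw [h0, norm_zero]
    exact norm_nonneg b
  · have hd := h.div_free_complex (isSmooth_mFourier (-k))
    have hc := h.curl_eq_complex (isSmooth_mFourier (-k))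
    simp only [pairing_pderiv_mFourier, pairing_mFourier] at hd hc
    change -(2 * Real.pi * Complex.I * k 0) * a 0 + -(2 * Real.pi * Complex.I * k 1) * a 1 = 0 at hd
    change -(2 * Real.pi * Complex.I * k 1) * a 0 - -(2 * Real.pi * Complex.I * k 0) * a 1 = b at hc
    have hpi : (2 * Real.pi * Complex.I : ℂ) ≠ 0 := by
      simp [Real.pi_ne_zero, Complex.I_ne_zero]
    have hd' : (k 0 : ℂ) * a 0 + k 1 * a 1 = 0 := by
      have : (2 * Real.pi * Complex.I : ℂ) * (k 0 * a 0 + k 1 * a 1) = 0 := by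
        linear_combination -hd
      exact (mul_eq_zero.1 this).resolve_left hpi
    have hs : ∀ i, (2 * Real.pi * Complex.I : ℂ) * ((k 0 : ℂ) ^ 2 + (k 1 : ℂ) ^ 2) * a i
        = (if i = 0 then -(k 1 : ℂ) else k 0) * b := by
      intro i
      fin_cases i
      · simp
        linear_combination (-(k 1 : ℂ)) * hc + (2 * Real.pi * Complex.I * k 0 : ℂ) * hd'
      · simp
        linear_combination (k 0 : ℂ) * hc + (2 * Real.pi * Complex.I * k 1 : ℂ) * hd'
    have hn := congrArg norm (hs i)
    simp only [norm_mul, Complex.norm_I, mul_one, Complex.norm_ofNat, Complex.norm_real,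
      Real.norm_eq_abs, abs_of_pos Real.pi_pos] at hn
    have hq : (1 : ℤ) ≤ k 0 ^ 2 + k 1 ^ 2 := by
      have : k 0 ≠ 0 ∨ k 1 ≠ 0 := by
        by_contra! hcon
        exact hk (by ext j; fin_cases j <;> simp [hcon.1, hcon.2])
      rcases this with h0 | h0 <;> have := sq_pos_of_ne_zero h0 <;>
        nlinarith [sq_nonneg (k 0), sq_nonneg (k 1)]
    have e1 : ‖(k 0 : ℂ) ^ 2 + (k 1 : ℂ) ^ 2‖ = (k 0 : ℝ) ^ 2 + (k 1 : ℝ) ^ 2 := by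
      have : (k 0 : ℂ) ^ 2 + (k 1 : ℂ) ^ 2 = (((k 0 : ℝ) ^ 2 + (k 1 : ℝ) ^ 2 : ℝ) : ℂ) := by
        push_cast; rfl
      rw [this, Complex.norm_real, Real.norm_eq_abs, abs_of_nonneg (by positivity)]
    have e2 : ‖(if i = 0 then -(k 1 : ℂ) else k 0)‖ ≤ (k 0 : ℝ) ^ 2 + (k 1 : ℝ) ^ 2 := by
      have hsq : ∀ n : ℤ, |(n : ℝ)| ≤ (n : ℝ) ^ 2 := fun n => by
        have : |n| ≤ n ^ 2 := by
          rw [← sq_abs]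
          exact Int.le_self_sq |n|
        exact_mod_cast this
      split_ifs
      · rw [norm_neg, Complex.norm_intCast]
        have := hsq (k 1)
        nlinarith [sq_nonneg (k 0 : ℝ)]
      · rw [Complex.norm_intCast]
        have := hsq (k 0)
        nlinarith [sq_nonneg (k 1 : ℝ)]
    rw [e1] at hn
    set q : ℝ := (k 0 : ℝ) ^ 2 + (k 1 : ℝ) ^ 2 with hqd
    have hq1 : 1 ≤ q := by rw [hqd]; exact_mod_cast hq
    have hle : 2 * Real.pi * q * ‖a i‖ ≤ q * ‖b‖ := by
      rw [hn]; gcongr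
    have hpi1 : 1 ≤ 2 * Real.pi := by linarith [Real.pi_gt_three]
    have hle2 : q * ‖a i‖ ≤ q * ‖b‖ := by
      refine le_trans ?_ hle
      rw [mul_assoc]
      exact le_mul_of_one_le_left (by positivity) hpi1
    exact le_of_mul_le_mul_left hle2 (by linarith)

/-- The Biot–Savart operator is bounded on `L²`. -/
lemma norm_le (h : IsVelocityOf u w) (i : Fin 2) : ‖u i‖ ≤ ‖w‖ := by
  refine (sq_le_sq₀ (norm_nonneg _) (norm_nonneg _)).1 ?_
  exact hasSum_le (fun k => pow_le_pow_left₀ (norm_nonneg _) (h.norm_mFourierCoeff_le i k) 2)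
    (hasSum_sq_mFourierCoeff_ofReal (u i)) (hasSum_sq_mFourierCoeff_ofReal w)

lemma sub (h : IsVelocityOf u w) (h' : IsVelocityOf v z) :
    IsVelocityOf (fun i => u i - v i) (w - z) where
  mean_zero i := by
    have e : ∫ x, (u i - v i) x ∂torusMeasure = ∫ x, (u i x - v i x) ∂torusMeasure :=
      integral_congr_ae (Lp.coeFn_sub _ _)
    rw [e, integral_sub ((Lp.memLp _).integrable (by norm_num))
      ((Lp.memLp _).integrable (by norm_num)), h.mean_zero, h'.mean_zero, sub_zero]
  div_free ψ hψ := by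
    rw [pairing_sub _ _ (hψ.pderiv 0).continuous, pairing_sub _ _ (hψ.pderiv 1).continuous]
    linear_combination h.div_free ψ hψ - h'.div_free ψ hψ
  curl_eq ψ hψ := by
    rw [pairing_sub _ _ (hψ.pderiv 0).continuous, pairing_sub _ _ (hψ.pderiv 1).continuous,
      pairing_sub _ _ hψ.continuous]
    linear_combination h.curl_eq ψ hψ - h'.curl_eq ψ hψ

end IsVelocityOf

lemma continuousOn_velocity {w : ℝ → L2} {u : ℝ → Fin 2 → L2} {s : Set ℝ}
    (hw : ContinuousOn w s) (hu : ∀ r ∈ s, IsVelocityOf (u r) (w r)) (i : Fin 2) :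
    ContinuousOn (fun r => u r i) s := by
  intro r hr
  rw [ContinuousWithinAt, tendsto_iff_norm_sub_tendsto_zero]
  refine squeeze_zero' (Eventually.of_forall fun _ => norm_nonneg _) ?_
    (tendsto_iff_norm_sub_tendsto_zero.1 (hw r hr))
  filter_upwards [self_mem_nhdsWithin] with t ht
  exact ((hu t ht).sub (hu r hr)).norm_le i

/-- The drift `⟨ω, u · ∇φ + Δφ⟩` is continuous in time, as the velocity depends linearly and
boundedly on `ω` in `L²`. -/
lemma continuousOn_drift {w : ℝ → L2} {u : ℝ → Fin 2 → L2} {s : Set ℝ} (hw : ContinuousOn w s)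
    (hu : ∀ r ∈ s, IsVelocityOf (u r) (w r)) {φ : Torus → ℝ} (hφ : IsSmooth φ) :
    ContinuousOn (fun r => pairing (w r)
      fun x => transport (fun i => ⇑(u r i)) φ x + laplacian φ x) s := by
  obtain ⟨L, hL⟩ := exists_clm_eq_pairing hφ.laplacian.continuous
  choose B hB using fun i => exists_clm_eq_integral_mul (hφ.pderiv i).continuous
  have e : ∀ r, pairing (w r) (fun x => transport (fun i => ⇑(u r i)) φ x + laplacian φ x)
      = (∑ i, B i (w r) (u r i)) + L (w r) := fun r => by
    have h1 : ∀ i, B i (w r) (u r i) = ∫ x, w r x * (u r i x * pderiv i φ x) ∂torusMeasure :=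
      fun i => (hB i _ _).2
    simp_rw [h1]
    rw [hL, ← integral_finsetSum _ fun i _ => (hB i _ _).1, pairing, pairing, ← integral_add
      (integrable_finsetSum _ fun i _ => (hB i _ _).1)
      (integrable_smul_of_continuous _ hφ.laplacian.continuous)]
    refine integral_congr_ae (Eventually.of_forall fun x => ?_)
    simp only [transport, smul_eq_mul, Finset.mul_sum, mul_add]
  simp_rw [e]
  refine ContinuousOn.add (continuousOn_finsetSum _ fun i _ => ?_)
    (L.continuous.comp_continuousOn hw)
  exact ((B i).continuous.comp_continuousOn hw).clm_apply (continuousOn_velocity hw hu i)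

/-! ### Square variation of the weak solution -/

/-- As `H ^ s ⊆ L²` for `s ≥ 0`, the paths of a weak solution are Hölder continuous in `L²`. -/
lemma IsWeakSolution.ae_norm_sub_le {α γ T : ℝ} {ξ : Fin 2 → Torus → ℝ} {W : ℝ → Ω → ℝ}
    {P : Measure Ω} {ω : ℝ → Ω → L2} {u : ℝ → Ω → Fin 2 → L2}
    (hω : IsWeakSolution α γ T ξ W P ω u) (hαγ : γ ≤ α) :
    ∀ᵐ p ∂P, ∃ C : ℝ, 0 ≤ C ∧
      ∀ r ∈ Set.Icc 0 T, ∀ t ∈ Set.Icc 0 T, ‖ω t p - ω r p‖ ≤ C * |t - r| ^ γ := by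
  filter_upwards [hω.holder_path] with p hp
  exact hp.exists_norm_sub_le (by linarith)

/-- For real test functions, the rescaled dyadic square variation of `⟨ω, ψ⟩` converges to
`∫ ⟨ω_s, ξ · ∇ψ⟩² ds`. -/
lemma IsWeakSolution.ae_tendsto_dyadicVariation {H : ℝ} {W : ℝ → Ω → ℝ} {P : Measure Ω}
    [IsProbabilityMeasure P] (hW : IsFractionalBrownianMotion H W P) (hH : 1 / 2 < H) (hH' : H < 1)
    {α γ T : ℝ} (hαγ : γ ≤ α) (hγ : 1 / 2 < γ) {ξ : Fin 2 → Torus → ℝ} (hξ : ∀ i, IsSmooth (ξ i))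
    {ω : ℝ → Ω → L2} {u : ℝ → Ω → Fin 2 → L2} (hω : IsWeakSolution α γ T ξ W P ω u)
    {ψ : Torus → ℝ} (hψ : IsSmooth ψ) {t : ℝ} (ht : 0 < t) (htT : t ≤ T) :
    ∀ᵐ p ∂P, Tendsto (fun k => ((2 : ℝ) ^ (2 * H - 1)) ^ k *
      dyadicVariation (fun s => pairing (ω s p) ψ) t k) atTop
      (𝓝 (∫ s in (0 : ℝ)..t, pairing (ω s p) (transport ξ ψ) ^ 2)) := by
  have hw : ∀ᵐ p ∂P, ∀ N i : ℕ, Tendsto (fun k => ((2 : ℝ) ^ (2 * H - 1)) ^ k *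
      dyadicVariation (fun s => W s p) (t * i / N) k) atTop (𝓝 (t * i / N)) :=
    ae_all_iff.2 fun N => ae_all_iff.2 fun i =>
      hW.ae_tendsto_dyadicVariation hH.le hH' (by positivity)
  have hX : ∀ᵐ p ∂P, ∀ k j : ℕ, (j : ℝ) / 2 ^ k ≤ t → HasYoungIntegral
      (fun s => pairing (ω s p) (transport ξ ψ)) (fun s => W s p) ((j : ℝ) / 2 ^ k)
      (pairing (ω ((j : ℝ) / 2 ^ k) p) ψ - pairing (ω 0 p) ψ -
        ∫ s in (0 : ℝ)..(j : ℝ) / 2 ^ k,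
          pairing (ω s p) fun x => transport (fun i => ⇑(u s p i)) ψ x + laplacian ψ x) := by
    refine ae_all_iff.2 fun k => ae_all_iff.2 fun j => ?_
    by_cases hj : (j : ℝ) / 2 ^ k ≤ t
    · filter_upwards [hω.weak_form ψ hψ ((j : ℝ) / 2 ^ k) ⟨by positivity, hj.trans htT⟩] with p hp _
      exact hp
    · exact Eventually.of_forall fun p h => absurd h hj
  obtain ⟨L, hL⟩ := exists_clm_eq_pairing (IsSmooth.transport hξ hψ).continuous
  filter_upwards [hw, hX, hω.ae_norm_sub_le hαγ, hω.velocity] with p hwp hXp ⟨C, hC0, hC⟩ hup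
  have hsub : Set.Icc 0 t ⊆ Set.Icc 0 T := Set.Icc_subset_Icc_right htT
  have hc : ContinuousOn (fun s => ω s p) (Set.Icc 0 T) :=
    continuousOn_of_norm_sub_le (by linarith) hC
  refine tendsto_dyadicVariation_of_hasYoungIntegral (C := ‖L‖ * C) ht (by linarith)
    (by linarith : 1 < γ + H) hH' hwp (fun r hr s hs => ?_)
    ((continuousOn_drift hc hup hψ).mono hsub) hXp
  rw [← hL, ← hL, ← map_sub, ← Real.norm_eq_abs, mul_assoc]
  exact (L.le_opNorm _).trans (by gcongr; exact hC r (hsub hr) s (hsub hs))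

/-- If the rescaled square variation has a positive limit, the ratio estimator converges to `H`. -/
lemma tendsto_hurstEstimator {E : Type*} [NormedAddCommGroup E] {X : ℝ → E} {t H I : ℝ}
    (hI : 0 < I) (h : Tendsto (fun k => ((2 : ℝ) ^ (2 * H - 1)) ^ k * dyadicVariation X t k) atTop
      (𝓝 I)) :
    Tendsto (fun k => hurstEstimator X t k) atTop (𝓝 H) := by
  set a : ℝ := (2 : ℝ) ^ (2 * H - 1) with ha
  have ha0 : 0 < a := by positivity
  have h1 : Tendsto (fun k => dyadicVariation X t k / dyadicVariation X t (k + 1)) atTop (𝓝 a) := by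
    have h2 := (h.div (h.comp (tendsto_add_atTop_nat 1)) hI.ne').const_mul a
    rw [div_self hI.ne', mul_one] at h2
    refine h2.congr fun k => ?_
    simp only [Pi.div_apply, Function.comp]
    rw [pow_succ, mul_assoc, mul_div_mul_left _ _ (by positivity), mul_div_assoc',
      mul_div_mul_left _ _ ha0.ne']
  have h3 := (((h1.log ha0.ne').const_mul (1 / Real.log 2)).add_const 1).const_mul (1 / 2)
  have hl : Real.log 2 ≠ 0 := (Real.log_pos one_lt_two).ne'
  have e : 1 / 2 * (1 / Real.log 2 * Real.log a + 1) = H := by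
    rw [ha, Real.log_rpow two_pos]
    field_simp
    ring
  rwa [e] at h3

/-- The square variation of a path splits into those of its real and imaginary parts. -/
lemma dyadicVariation_eq_re_add_im {𝕜 : Type*} [RCLike 𝕜] (X : ℝ → 𝕜) (t : ℝ) (k : ℕ) :
    dyadicVariation X t k = dyadicVariation (fun s => RCLike.reCLM (K := 𝕜) (X s)) t k
      + dyadicVariation (fun s => RCLike.imCLM (K := 𝕜) (X s)) t k := by
  simp only [dyadicVariation, ← Finset.sum_add_distrib]
  refine Finset.sum_congr rfl fun j _ => ?_
  rw [RCLike.norm_sq_eq_def, ← map_sub, ← map_sub]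
  simp [sq]

end FractionalVorticity

theorem mainTheorem3 {Ω : Type*} [MeasurableSpace Ω] (P : Measure Ω) [IsProbabilityMeasure P]
    {H : ℝ} (hH : 1 / 2 < H) (hH' : H < 1)
    {W : ℝ → Ω → ℝ} (hW : FractionalVorticity.IsFractionalBrownianMotion H W P)
    {α γ T : ℝ} (hα : 1 < α) (hγ : 1 / 2 < γ) (hγ' : γ < H)
    {ξ : Fin 2 → FractionalVorticity.Torus → ℝ}
    (hξ : ∀ i, FractionalVorticity.IsSmooth (ξ i))
    (hξ' : ∀ x, FractionalVorticity.divergence ξ x = 0)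
    {ω : ℝ → Ω → FractionalVorticity.L2} {u : ℝ → Ω → Fin 2 → FractionalVorticity.L2}
    (hω : FractionalVorticity.IsWeakSolution α γ T ξ W P ω u)
    {𝕜 : Type*} [RCLike 𝕜] {φ : FractionalVorticity.Torus → 𝕜}
    (hφ : FractionalVorticity.IsSmooth φ)
    {t : ℝ} (ht : 0 < t) (htT : t ≤ T) :
    ∀ᵐ p ∂P,
      0 < ∫ s in (0 : ℝ)..t,
        ‖FractionalVorticity.pairing (ω s p) (FractionalVorticity.transport ξ φ)‖ ^ 2 →
      Tendsto
        (fun k => FractionalVorticity.hurstEstimator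
          (fun s => FractionalVorticity.pairing (ω s p) φ) t k)
        atTop (𝓝 H) := by
  open FractionalVorticity in
  have hαγ : γ ≤ α := by linarith
  have hre := hω.ae_tendsto_dyadicVariation hW hH hH' hαγ hγ hξ
    (hφ.clm_comp (RCLike.reCLM (K := 𝕜))) ht htT
  have him := hω.ae_tendsto_dyadicVariation hW hH hH' hαγ hγ hξ
    (hφ.clm_comp (RCLike.imCLM (K := 𝕜))) ht htT
  have htr : Continuous (transport ξ φ) := (IsSmooth.transport hξ hφ).continuous
  obtain ⟨L, hL⟩ := exists_clm_eq_pairing htr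
  filter_upwards [hre, him, hω.ae_norm_sub_le hαγ] with p hrep himp ⟨C, _, hC⟩ hpos
  refine tendsto_hurstEstimator hpos ?_
  have hc : ContinuousOn (fun s => pairing (ω s p) (transport ξ φ)) (Set.uIcc 0 t) := by
    rw [Set.uIcc_of_le ht.le]
    simp_rw [← hL]
    exact L.continuous.comp_continuousOn ((continuousOn_of_norm_sub_le (by linarith) hC).mono
      (Set.Icc_subset_Icc_right htT))
  simp only [hφ.transport_clm_comp, pairing_clm_comp _ _ htr,
    pairing_clm_comp _ _ hφ.continuous] at hrep himp
  have hs : ∫ s in (0 : ℝ)..t, ‖pairing (ω s p) (transport ξ φ)‖ ^ 2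
      = (∫ s in (0 : ℝ)..t, RCLike.reCLM (K := 𝕜) (pairing (ω s p) (transport ξ φ)) ^ 2)
        + ∫ s in (0 : ℝ)..t, RCLike.imCLM (K := 𝕜) (pairing (ω s p) (transport ξ φ)) ^ 2 := by
    rw [← intervalIntegral.integral_add
      (by exact
        (((RCLike.reCLM (K := 𝕜)).continuous.comp_continuousOn hc).pow 2).intervalIntegrable)
      (by exact
        (((RCLike.imCLM (K := 𝕜)).continuous.comp_continuousOn hc).pow 2).intervalIntegrable)]
    refine intervalIntegral.integral_congr fun s _ => ?_
    rw [RCLike.norm_sq_eq_def]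
    simp only [RCLike.reCLM_apply, RCLike.imCLM_apply, sq]
  rw [hs]
  simp only [dyadicVariation_eq_re_add_im (fun s => pairing (ω s p) φ), mul_add]
  exact hrep.add himp
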